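/- Let $P^a,P^b$ be probability measures on a measurable space $\mathcal Y$. Let $Y^a_1,Y^a_2,\ldots$ be i.i.d. with law $P^a$ and, independent of them, $Y^b_1,Y^b_2,\ldots$ i.i.d. with law $P^b$. Let $n_a,n_b\to\infty$ with $n_a/n_b\to\lambda\in\mathbb R$. Write $Pf=\int f\,dP$, $\mathbb P^a_{n_a}f=n_a^{-1}\sum_{i\le n_a}f(Y^a_i)$, $\mathbb P^b_{n_b}f=n_b^{-1}\sum_{i\le n_b}f(Y^b_i)$. Let $\mathcal F$ be a class of functions $\mathcal Y\to\mathbb R$ that is both $P^a$-Donsker and $P^b$-Donsker. Here $\mathcal F$ is $P$-Donsker if its members are measurable and $P$-square-integrable and, for the coordinate projections $X_i$ on $(\mathcal Y^{\infty},P^{\infty})$, the process $f\mapsto\sqrt n\,\bigl(n^{-1}\sum_{i\le n}f(X_i)-Pf\bigr)$ takes values in $\ell^\infty(\mathcal F)$ and converges weakly there (in the Hoffmann-Jørgensen sense, i.e. outer expectations of bounded continuous functionals converge) to a tight Borel probability law. Put $$\mathbb G^\Delta_n f=\sqrt{n_a}\,\bigl[(\mathbb P^a_{n_a}f-\mathbb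 P^b_{n_b}f)-(P^af-P^bf)\bigr],$$ $$K(f,g)=P^a(fg)-P^af\,P^ag+\lambda\,[P^b(fg)-P^bf\,P^bg],\qquad \sigma_f^2=K(f,f).$$ Assume that $\inf_{f\in\mathcal F}\sigma_f^2>0$ and that $\hat\sigma_f$ are (random) estimators, not necessarily measurable, with $\sup_{f\in\mathcal F}|\hat\sigma_f-\sigma_f|\to0$ in (outer) probability. Then there is a mean-zero Gaussian process $\mathbb G^\Delta$ indexed by $\mathcal F$, with covariance function $K$, that is a tight Borel random element of $\ell^\infty(\mathcal F)$. For every such process, with $T_f=\mathbb G^\Delta f/\sigma_f$ and $\hat T_f=\mathbb G^\Delta_nf/\hat\sigma_f$: 1. for each $f\in\mathcal F$, $\hat T_f\xrightarrow{d}T_f\sim N(0,1)$; 2. for each nonempty $\mathcal S\subseteq\mathcal F$, $$\sup_{f\in\mathcal S}\hat T_f\xrightarrow{d}\sup_{f\in\mathcal S}T_f,\qquad \inf_{f\in\mathcal S}\hat T_f\xrightarrow{d}\inf_{f\in\mathcal S}T_f,\qquad \sup_{f\in\mathcal S}|\hat T_f|\xrightarrow{d}\sup_{f\in\mathcal S}|T_f|.$$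 Convergence in distribution of possibly non-measurable variables is again meant in the sense of outer expectations; for measurable ones it is the usual notion. Where $\hat\sigma_f=0$ or a supremum or infimum of the $\hat T_f$ is not finite (events whose outer probability tends to $0$), any fixed real value, here $0$, may be assigned. -/

import Mathlib

open Filter Topology MeasureTheory ProbabilityTheory
open scoped ENNReal BoundedContinuousFunction

noncomputable section

namespace EUProcess

/-! ### Weak convergence of possibly non-measurable maps -/

/-- The space `ℓ^∞(ι)` of bounded functions `ι → ℝ` with the supremum norm. -/
abbrev EllInfty (ι : Type*) := lp (fun _ : ι => ℝ) ∞

instance instMeasurableSpaceEllInfty (ι : Type*) : MeasurableSpace (EllInfty ι) := borel _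

instance instBorelSpaceEllInfty (ι : Type*) : BorelSpace (EllInfty ι) := ⟨rfl⟩

/-- The outer expectation `E^* Z` of a bounded, not necessarily measurable, function `Z`: the
infimum of the expectations of the measurable integrable functions that lie above `Z`. -/
def outerExp {Ω : Type*} [MeasurableSpace Ω] (μ : Measure Ω) (Z : Ω → ℝ) : ℝ :=
  sInf {r : ℝ | ∃ U : Ω → ℝ, Measurable U ∧ Integrable U μ ∧ (∀ ω, Z ω ≤ U ω) ∧ r = ∫ ω, U ω ∂μ}

/-- For a measurable integrable function the outer expectation is the expectation. -/
theorem outerExp_eq_integral {Ω : Type*} [MeasurableSpace Ω] (μ : Measure Ω) (Z : Ω → ℝ)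
    (hZ : Measurable Z) (hi : Integrable Z μ) : outerExp μ Z = ∫ ω, Z ω ∂μ := by
  refine IsLeast.csInf_eq ⟨⟨Z, hZ, hi, fun _ => le_rfl, rfl⟩, ?_⟩
  rintro r ⟨U, -, hU, hle, rfl⟩
  exact integral_mono hi hU hle

/-- Weak convergence (in the sense of Hoffmann-Jørgensen) of arbitrary maps `Z k : Ω → E` to the
Borel law `ν`: `E^* h(Z k) → ∫ h dν` for every bounded continuous `h : E → ℝ`. For measurable
`Z k` this is ordinary convergence in distribution. -/
def WeakConv {Ω E : Type*} [MeasurableSpace Ω] [TopologicalSpace E] [MeasurableSpace E]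
    (μ : Measure Ω) (Z : ℕ → Ω → E) (ν : Measure E) : Prop :=
  ∀ h : E →ᵇ ℝ, Tendsto (fun k => outerExp μ (fun ω => h (Z k ω))) atTop (𝓝 (∫ z, h z ∂ν))

/-! ### Empirical processes and Donsker classes -/

variable {𝒴 : Type*} [MeasurableSpace 𝒴]

/-- The empirical mean `ℙ_n f` of the first `n` terms of the sequence `y`. -/
def empMean (n : ℕ) (y : ℕ → 𝒴) (f : 𝒴 → ℝ) : ℝ :=
  (∑ i ∈ Finset.range n, f (y i)) / n

/-- `𝔾_n f = √n (ℙ_n f - P f)`, as a function of the sample `y`. -/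
def empProc (P : Measure 𝒴) (n : ℕ) (y : ℕ → 𝒴) (f : 𝒴 → ℝ) : ℝ :=
  √(n : ℝ) * (empMean n y f - ∫ x, f x ∂P)

/-- `F` is a `P`-Donsker class: a class of measurable square-integrable functions whose empirical
process is a map into `ℓ^∞(F)` that converges weakly there to a tight Borel probability law. The
observations are the coordinate projections on the infinite product probability space. -/
structure IsDonsker (P : Measure 𝒴) (F : Set (𝒴 → ℝ)) : Prop where
  measurable : ∀ f ∈ F, Measurable f
  memLp : ∀ f ∈ F, MemLp f 2 P
  weakConv : ∃ G : ℕ → (ℕ → 𝒴) → EllInfty F,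
    (∀ n y (f : F), G n y f = empProc P n y f) ∧
    ∃ ν : Measure (EllInfty F), IsProbabilityMeasure ν ∧ IsTightMeasureSet {ν} ∧
      WeakConv (Measure.infinitePi fun _ : ℕ => P) G ν

/-- `ν` is the law of a mean-zero Gaussian process with covariance function `K`, indexed by `ι`,
that is a tight Borel random element of `ℓ^∞(ι)`. -/
structure IsTightGaussianLaw {ι : Type*} (ν : Measure (EllInfty ι)) (K : ι → ι → ℝ) : Prop where
  isProbabilityMeasure : IsProbabilityMeasure ν
  tight : IsTightMeasureSet {ν}
  gaussian : IsGaussianProcess (fun (f : ι) (z : EllInfty ι) => z f) ν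
  mean_zero : ∀ f, ∫ z, z f ∂ν = 0
  cov : ∀ f g, ∫ z, z f * z g ∂ν = K f g

/-! ### The two-sample problem -/

/-- Two i.i.d. samples, with distributions `Pa` and `Pb`, independent of each other. -/
structure TwoSamples {Ω : Type*} [MeasurableSpace Ω] (μ : Measure Ω) (Ya Yb : ℕ → Ω → 𝒴)
    (Pa Pb : Measure 𝒴) : Prop where
  measurable_a : ∀ i, Measurable (Ya i)
  measurable_b : ∀ i, Measurable (Yb i)
  law_a : ∀ i, μ.map (Ya i) = Pa
  law_b : ∀ i, μ.map (Yb i) = Pb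
  indep_a : iIndepFun Ya μ
  indep_b : iIndepFun Yb μ
  indep_ab : IndepFun (fun ω i => Ya i ω) (fun ω i => Yb i ω) μ

/-- The sample sizes `na k`, `nb k` tend to infinity and their ratio tends to `lam`. -/
structure SampleSizes (na nb : ℕ → ℕ) (lam : ℝ) : Prop where
  tendsto_a : Tendsto na atTop atTop
  tendsto_b : Tendsto nb atTop atTop
  tendsto_ratio : Tendsto (fun k => (na k : ℝ) / (nb k : ℝ)) atTop (𝓝 lam)

/-- `𝔾^Δ f = √n_a [(ℙ^a f - ℙ^b f) - (P^a f - P^b f)]`, as a function of the two samples. -/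
def diffProc (Pa Pb : Measure 𝒴) (na nb : ℕ) (ya yb : ℕ → 𝒴) (f : 𝒴 → ℝ) : ℝ :=
  √(na : ℝ) * ((empMean na ya f - empMean nb yb f) - (∫ x, f x ∂Pa - ∫ x, f x ∂Pb))

/-- `P fg - P f P g`. -/
def bridgeCov (P : Measure 𝒴) (f g : 𝒴 → ℝ) : ℝ :=
  ∫ x, f x * g x ∂P - (∫ x, f x ∂P) * ∫ x, g x ∂P

/-- The covariance function of the limit of `𝔾^Δ` when `n_a / n_b → lam`. -/
def diffCov (Pa Pb : Measure 𝒴) (lam : ℝ) (f g : 𝒴 → ℝ) : ℝ :=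
  bridgeCov Pa f g + lam * bridgeCov Pb f g

/-- The standard deviation `σ_f` of the limit of `𝔾^Δ f`. -/
def sigma (Pa Pb : Measure 𝒴) (lam : ℝ) (f : 𝒴 → ℝ) : ℝ :=
  √(diffCov Pa Pb lam f f)

/-- `T_f = 𝔾^Δ f / σ_f`, as a function of the path `z` of the limit process `𝔾^Δ`. -/
def tLimit (Pa Pb : Measure 𝒴) (lam : ℝ) {F : Set (𝒴 → ℝ)} (z : EllInfty F) (f : F) : ℝ :=
  z f / sigma Pa Pb lam f

/-- `T̂_f = 𝔾^Δ f / σ̂_f` at stage `k` (sample sizes `na k`, `nb k`) and outcome `ω`. -/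
def tStat {Ω : Type*} (Pa Pb : Measure 𝒴) (na nb : ℕ → ℕ) (Ya Yb : ℕ → Ω → 𝒴)
    {F : Set (𝒴 → ℝ)} (sigmaHat : ℕ → Ω → F → ℝ) (k : ℕ) (ω : Ω) (f : F) : ℝ :=
  diffProc Pa Pb (na k) (nb k) (fun i => Ya i ω) (fun i => Yb i ω) f / sigmaHat k ω f

/-- `sup_{f ∈ F} |σ̂_f - σ_f| → 0` in (outer) probability. The supremum is taken in `[0, ∞]`. -/
def UniformlyConsistent {Ω : Type*} [MeasurableSpace Ω] (μ : Measure Ω) {ι : Type*}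
    (sigmaHat : ℕ → Ω → ι → ℝ) (σ : ι → ℝ) : Prop :=
  ∀ ε : ℝ, 0 < ε → Tendsto
    (fun k => μ {ω | ENNReal.ofReal ε < ⨆ f, ENNReal.ofReal |sigmaHat k ω f - σ f|}) atTop (𝓝 0)

end EUProcess

end

noncomputable section

namespace EUProcess

/-! ### Outer expectations -/

section OuterExp

variable {Ω : Type*} [MeasurableSpace Ω] {μ : Measure Ω} [IsProbabilityMeasure μ]

/-! Evaluation at a point, supremum, infimum and supremum of absolute values are all 1-Lipschitz in
the uniform norm, and division by `σ` is Lipschitz because `σ` is bounded below. So one statement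
about a Lipschitz functional `Ψ` suffices; it is `weakConv_of_fdd`, which needs only asymptotic
tightness and convergence of finite-dimensional distributions.

Tightness is used in this form: outside small probability, a path lies uniformly within `ε` of a
finite set of bounded functions (`nearNet`). Such a set is nearly constant on the cells of a finite
partition of the index set, so a path `u` is uniformly close to `u ∘ p` with `p` of finite range,
and `Ψ` is approximated by a continuous function of finitely many coordinates. No measurability of
the original functional is needed, since outer expectations are compared with integrals of
measurable approximants.

Both inputs come from `diffProc_eq`: the process is `𝔾^a - √(n_a/n_b) 𝔾^b` with independent terms.
Finite-dimensional limits follow from the scalar central limit theorem, Cramér–Wold and a product of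
characteristic functions; tightness follows by combining nets of the two Donsker classes. The limit
law exists as that of `𝔾^a + √λ 𝔾^b`, built from independent copies of the two Donsker limits. -/

theorem outerExp_le_integral {Z U : Ω → ℝ} {B : ℝ} (hB : ∀ ω, |Z ω| ≤ B) (hU : Measurable U)
    (hi : Integrable U μ) (hle : ∀ ω, Z ω ≤ U ω) : outerExp μ Z ≤ ∫ ω, U ω ∂μ := by
  refine csInf_le ⟨-B, ?_⟩ ⟨U, hU, hi, hle, rfl⟩
  rintro r ⟨V, -, hV, hle, rfl⟩
  have : ∫ _, -B ∂μ ≤ ∫ ω, V ω ∂μ :=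
    integral_mono (integrable_const _) hV fun ω => (neg_le_of_abs_le (hB ω)).trans (hle ω)
  simpa using this

theorem exists_integral_lt_outerExp_add {Z : Ω → ℝ} {B : ℝ} (hB : ∀ ω, |Z ω| ≤ B) {ε : ℝ}
    (hε : 0 < ε) : ∃ U : Ω → ℝ, Measurable U ∧ Integrable U μ ∧ (∀ ω, Z ω ≤ U ω) ∧
      ∫ ω, U ω ∂μ < outerExp μ Z + ε := by
  have hne : {r : ℝ | ∃ U : Ω → ℝ, Measurable U ∧ Integrable U μ ∧ (∀ ω, Z ω ≤ U ω) ∧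
      r = ∫ ω, U ω ∂μ}.Nonempty :=
    ⟨_, fun _ => B, measurable_const, integrable_const _, fun ω => (abs_le.1 (hB ω)).2, rfl⟩
  obtain ⟨r, ⟨U, hU, hi, hle, rfl⟩, hr⟩ := Real.lt_sInf_add_pos hne hε
  exact ⟨U, hU, hi, hle, hr⟩

/-- `Z` is squeezed between `V - R` and `V + R`, where `R` is `ε` plus `2B` on a measurable hull of
the exceptional set `A`. Neither `Z` nor `A` has to be measurable. -/
theorem abs_outerExp_sub_integral_le {Z V : Ω → ℝ} {B ε η : ℝ} {A : Set Ω}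
    (hZ : ∀ ω, |Z ω| ≤ B) (hVB : ∀ ω, |V ω| ≤ B) (hV : Measurable V) (hε : 0 ≤ ε) (hη : 0 ≤ η)
    (hA : μ A ≤ ENNReal.ofReal η) (hZV : ∀ ω, ω ∉ A → |Z ω - V ω| ≤ ε) :
    |outerExp μ Z - ∫ ω, V ω ∂μ| ≤ ε + 2 * B * η := by
  have hB : 0 ≤ B := by
    obtain ⟨ω⟩ : Nonempty Ω := nonempty_of_isProbabilityMeasure μ
    exact (abs_nonneg _).trans (hZ ω)
  set A' := toMeasurable μ A
  have hA'm : MeasurableSet A' := measurableSet_toMeasurable μ A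
  have hA' : μ.real A' ≤ η := by
    rw [measureReal_def, measure_toMeasurable]
    exact ENNReal.toReal_le_of_le_ofReal hη hA
  set R : Ω → ℝ := fun ω => ε + A'.indicator (fun _ => 2 * B) ω
  have hRm : Measurable R := measurable_const.add (measurable_const.indicator hA'm)
  have hI : Integrable (A'.indicator (fun _ => 2 * B)) μ :=
    (integrable_const _).indicator hA'm
  have hRi : Integrable R μ := (integrable_const ε).add hI
  have hRint : ∫ ω, R ω ∂μ ≤ ε + 2 * B * η := by
    simp only [R]
    rw [integral_add (integrable_const ε) hI, integral_indicator hA'm]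
    simp only [integral_const, probReal_univ, one_mul, measureReal_restrict_apply_univ,
      smul_eq_mul]
    nlinarith
  have hZVR : ∀ ω, |Z ω - V ω| ≤ R ω := by
    intro ω
    by_cases h : ω ∈ A'
    · have h1 := abs_sub (Z ω) (V ω)
      have h2 := hZ ω
      have h3 := hVB ω
      simp only [R, Set.indicator_of_mem h]
      linarith
    · have : ω ∉ A := fun h' => h (subset_toMeasurable μ A h')
      simpa [R, h] using hZV ω this
  have hVi : Integrable V μ :=
    Integrable.of_bound hV.aestronglyMeasurable B (ae_of_all _ fun ω => by simpa using hVB ω)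
  rw [abs_le]
  constructor
  · refine le_of_forall_pos_le_add fun e he => ?_
    obtain ⟨U, -, hUi, hle, hlt⟩ := exists_integral_lt_outerExp_add (μ := μ) hZ he
    have : ∫ ω, V ω ∂μ - ∫ ω, R ω ∂μ ≤ ∫ ω, U ω ∂μ := by
      rw [← integral_sub hVi hRi]
      refine integral_mono (hVi.sub hRi) hUi fun ω => ?_
      have := (abs_le.1 (hZVR ω)).1
      have := hle ω
      simp only
      linarith
    linarith
  · have : outerExp μ Z ≤ ∫ ω, (V ω + R ω) ∂μ := by
      refine outerExp_le_integral hZ (hV.add hRm) (hVi.add hRi) fun ω => ?_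
      have := (abs_le.1 (hZVR ω)).2
      linarith
    rw [integral_add hVi hRi] at this
    linarith

end OuterExp

/-! ### Finite nets -/

section Nets

variable {ι : Type*}

/-- The functions on `ι` within uniform distance `ε` of some member of `s`. -/
def nearNet (s : Set (EllInfty ι)) (ε : ℝ) : Set (ι → ℝ) :=
  {u | ∃ w ∈ s, ∀ i, |u i - w i| ≤ ε}

theorem nearNet_mono {s t : Set (EllInfty ι)} (h : s ⊆ t) (ε : ℝ) :
    nearNet s ε ⊆ nearNet t ε := fun _ ⟨w, hw, hu⟩ => ⟨w, h hw, hu⟩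

theorem abs_apply_le_norm (z : EllInfty ι) (i : ι) : |z i| ≤ ‖z‖ :=
  lp.norm_apply_le_norm ENNReal.top_ne_zero z i

theorem abs_sub_apply_le_dist (z w : EllInfty ι) (i : ι) : |z i - w i| ≤ dist z w := by
  rw [dist_eq_norm]
  exact abs_apply_le_norm (z - w) i

theorem continuous_eval (i : ι) : Continuous fun z : EllInfty ι => z i :=
  (lp.evalCLM ℝ (fun _ : ι => ℝ) ∞ i).continuous

theorem measurable_eval (i : ι) : Measurable fun z : EllInfty ι => z i :=
  (continuous_eval i).measurable

theorem exists_finite_infDist {ν : Measure (EllInfty ι)} (hν : IsTightMeasureSet {ν})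
    {ε η : ℝ} (hε : 0 < ε) (hη : 0 < η) : ∃ s : Set (EllInfty ι), s.Finite ∧ s.Nonempty ∧
      ν {z | ε ≤ Metric.infDist z s} ≤ ENNReal.ofReal η := by
  obtain ⟨K, hK, hKν⟩ := isTightMeasureSet_iff_exists_isCompact_measure_compl_le.1 hν
    (ENNReal.ofReal η) (by simpa using hη)
  obtain ⟨s, hs, hfin, hcov⟩ := hK.finite_cover_balls hε
  -- `0` is added to keep the net nonempty: `Metric.infDist` to the empty set is `0` by default and
  -- would not yield a nearby point.
  refine ⟨insert 0 s, hfin.insert 0, Set.insert_nonempty 0 s,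
    (measure_mono fun z hz hzK => ?_).trans (hKν ν rfl)⟩
  obtain ⟨w, hw, hzw⟩ := Set.mem_iUnion₂.1 (hcov hzK)
  exact absurd ((Metric.infDist_le_dist_of_mem (Set.mem_insert_of_mem 0 hw)).trans_lt
    (Metric.mem_ball.1 hzw)) (not_lt.2 hz)

theorem mem_nearNet_of_infDist_lt {s : Set (EllInfty ι)} (hs : s.Nonempty) {ε : ℝ}
    {z : EllInfty ι} (h : Metric.infDist z s < ε) : (z : ι → ℝ) ∈ nearNet s ε := by
  obtain ⟨w, hw, hzw⟩ := (Metric.infDist_lt_iff hs).1 h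
  exact ⟨w, hw, fun i => (abs_sub_apply_le_dist z w i).trans hzw.le⟩

theorem exists_finite_nearNet {ν : Measure (EllInfty ι)} (hν : IsTightMeasureSet {ν})
    {ε η : ℝ} (hε : 0 < ε) (hη : 0 < η) : ∃ s : Set (EllInfty ι), s.Finite ∧
      ν {z | (z : ι → ℝ) ∉ nearNet s ε} ≤ ENNReal.ofReal η := by
  obtain ⟨s, hfin, hne, hs⟩ := exists_finite_infDist hν hε hη
  refine ⟨s, hfin, (measure_mono fun z hz => ?_).trans hs⟩
  by_contra h
  exact hz (mem_nearNet_of_infDist_lt hne (not_le.1 h))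

/-- A weakly convergent sequence of arbitrary maps with a tight limit is asymptotically tight. -/
theorem WeakConv.exists_finite_nearNet {Ω : Type*} [MeasurableSpace Ω] {μ : Measure Ω}
    [IsProbabilityMeasure μ] {G : ℕ → Ω → EllInfty ι} {ν : Measure (EllInfty ι)}
    [IsProbabilityMeasure ν] (hG : WeakConv μ G ν) (hν : IsTightMeasureSet {ν})
    {ε η : ℝ} (hε : 0 < ε) (hη : 0 < η) : ∃ s : Set (EllInfty ι), s.Finite ∧
      ∀ᶠ n in atTop, μ {ω | (G n ω : ι → ℝ) ∉ nearNet s ε} ≤ ENNReal.ofReal η := by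
  obtain ⟨s, hfin, hne, hs⟩ :=
    EUProcess.exists_finite_infDist hν (half_pos hε) (half_pos hη)
  refine ⟨s, hfin, ?_⟩
  have hε2 : 0 < ε / 2 := half_pos hε
  -- A continuous ramp: `0` up to distance `ε / 2` from the net, `1` from distance `ε` on.
  set h₀ : EllInfty ι → ℝ := fun z => max 0 (min 1 (Metric.infDist z s / (ε / 2) - 1))
  have h0 : ∀ z, 0 ≤ h₀ z := fun z => le_max_left _ _
  have h1 : ∀ z, h₀ z ≤ 1 := fun z => max_le zero_le_one (min_le_left _ _)
  have hc : Continuous h₀ := by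
    have := Metric.continuous_infDist_pt s
    fun_prop
  let h : EllInfty ι →ᵇ ℝ := BoundedContinuousFunction.ofNormedAddCommGroup h₀ hc 1 fun z => by
    rw [Real.norm_eq_abs, abs_of_nonneg (h0 z)]; exact h1 z
  have hmeas : MeasurableSet {z : EllInfty ι | ε / 2 ≤ Metric.infDist z s} :=
    (isClosed_le continuous_const (Metric.continuous_infDist_pt s)).measurableSet
  have hint : ∫ z, h z ∂ν ≤ η / 2 := by
    calc ∫ z, h z ∂ν ≤ ∫ z, {z | ε / 2 ≤ Metric.infDist z s}.indicator (fun _ => (1 : ℝ)) z ∂ν := by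
          refine integral_mono (h.integrable ν) ((integrable_const _).indicator hmeas) fun z => ?_
          by_cases hz : ε / 2 ≤ Metric.infDist z s
          · rw [Set.indicator_of_mem (by exact hz)]; exact h1 z
          · rw [Set.indicator_of_notMem (by exact hz)]
            refine max_le le_rfl ((min_le_right _ _).trans ?_)
            rw [sub_nonpos, div_le_one hε2]
            exact (not_le.1 hz).le
      _ = ν.real {z | ε / 2 ≤ Metric.infDist z s} := by
          rw [integral_indicator hmeas]; simp
      _ ≤ η / 2 := ENNReal.toReal_le_of_le_ofReal (half_pos hη).le hs
  have hev : ∀ᶠ n in atTop, outerExp μ (fun ω => h (G n ω)) < η * (3 / 4) :=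
    (hG h).eventually_lt_const (by linarith)
  filter_upwards [hev] with n hn
  obtain ⟨U, hUm, hUi, hle, hlt⟩ := exists_integral_lt_outerExp_add (μ := μ) (B := 1)
    (Z := fun ω => h (G n ω)) (fun ω => by
      change |h₀ (G n ω)| ≤ 1
      rw [abs_of_nonneg (h0 _)]; exact h1 _) (ε := η / 4) (by linarith)
  have hU0 : 0 ≤ U := fun ω => (h0 _).trans (hle ω)
  have hsub : {ω | (G n ω : ι → ℝ) ∉ nearNet s ε} ⊆ {ω | 1 ≤ U ω} := by
    intro ω hω
    refine le_trans ?_ (hle ω)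
    have : ε ≤ Metric.infDist (G n ω) s := by
      by_contra hcon
      exact hω (mem_nearNet_of_infDist_lt hne (not_le.1 hcon))
    change 1 ≤ h₀ (G n ω)
    refine le_max_of_le_right (le_min le_rfl ?_)
    rw [le_sub_iff_add_le, le_div_iff₀ hε2]
    linarith
  refine (measure_mono hsub).trans ?_
  -- Markov's inequality at level `1` for the measurable majorant `U`, whose integral is below `3η/4
  -- + η/4`.
  have hmk := mul_meas_ge_le_integral_of_nonneg (ae_of_all μ hU0) hUi 1
  rw [one_mul] at hmk
  rw [← ENNReal.ofReal_toReal (measure_ne_top μ {ω | 1 ≤ U ω})]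
  exact ENNReal.ofReal_le_ofReal (hmk.trans (by linarith))

/-- Label `i` by the integer parts of `w i / ε` for `w ∈ s`. Boundedness leaves finitely many
labels, and `p` sends `i` to a chosen index with the same label. -/
theorem exists_finite_range_approx {s : Set (EllInfty ι)} (hs : s.Finite) {ε : ℝ} (hε : 0 < ε) :
    ∃ p : ι → ι, (Set.range p).Finite ∧ ∀ w ∈ s, ∀ i, |w i - w (p i)| ≤ ε := by
  have := hs.fintype
  let q : ι → s → ℤ := fun i w => ⌊(w : EllInfty ι) i / ε⌋
  have hq : (Set.range q).Finite := by
    have hfin : (Set.pi Set.univ fun w : s =>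
        Set.Icc ⌊-‖(w : EllInfty ι)‖ / ε⌋ ⌊‖(w : EllInfty ι)‖ / ε⌋).Finite :=
      Set.Finite.pi fun w => Set.finite_Icc _ _
    refine hfin.subset ?_
    rintro _ ⟨i, rfl⟩ w -
    have := abs_le.1 (abs_apply_le_norm (w : EllInfty ι) i)
    exact ⟨Int.floor_mono (by gcongr; exact this.1), Int.floor_mono (by gcongr; exact this.2)⟩
  rcases isEmpty_or_nonempty ι with hι | hι
  · exact ⟨id, Set.toFinite _, fun w _ i => (hι.false i).elim⟩
  refine ⟨fun i => Function.invFun q (q i), ?_, fun w hw i => ?_⟩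
  · refine (hq.image (Function.invFun q)).subset ?_
    rintro _ ⟨i, rfl⟩
    exact ⟨q i, ⟨i, rfl⟩, rfl⟩
  · have h1 : q (Function.invFun q (q i)) = q i := Function.invFun_eq ⟨i, rfl⟩
    have h2 := Int.abs_sub_lt_one_of_floor_eq_floor (congrFun h1 ⟨w, hw⟩).symm
    rw [← sub_div, abs_div, abs_of_pos hε, div_lt_one hε] at h2
    exact h2.le

theorem abs_sub_le_of_mem_nearNet {s : Set (EllInfty ι)} {p : ι → ι} {ε : ℝ}
    (hp : ∀ w ∈ s, ∀ i, |w i - w (p i)| ≤ ε) {u : ι → ℝ} (hu : u ∈ nearNet s ε) (i : ι) :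
    |u i - u (p i)| ≤ 3 * ε := by
  obtain ⟨w, hw, h⟩ := hu
  have h1 := abs_le.1 (h i)
  have h2 := abs_le.1 (h (p i))
  have h3 := abs_le.1 (hp w hw i)
  rw [abs_le]
  constructor <;> linarith

theorem exists_bound_of_mem_nearNet {s : Set (EllInfty ι)} (hs : s.Finite) (ε : ℝ) :
    ∃ R : ℝ, 0 < R ∧ ∀ u ∈ nearNet s ε, ∀ i, |u i| ≤ R := by
  obtain ⟨C, hC⟩ := (hs.image norm).bddAbove
  refine ⟨max 1 (C + ε), lt_max_of_lt_left one_pos, ?_⟩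
  rintro u ⟨w, hw, h⟩ i
  refine le_max_of_le_right ?_
  have h1 := abs_apply_le_norm w i
  have h2 : ‖w‖ ≤ C := hC ⟨w, hw, rfl⟩
  have h3 := h i
  have h4 := abs_sub_abs_le_abs_sub (u i) (w i)
  linarith

end Nets

/-! ### Weak convergence of Lipschitz functionals -/

section LipschitzFunctionals

variable {ι : Type*}

/-- A functional on functions `ι → ℝ` that is `1`-Lipschitz near bounded functions. -/
def SupLipschitz (Ψ : (ι → ℝ) → ℝ) : Prop :=
  ∀ (u v : ι → ℝ) (δ : ℝ), 0 ≤ δ → (∃ C, ∀ i, |v i| ≤ C) → (∀ i, |u i - v i| ≤ δ) →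
    |Ψ u - Ψ v| ≤ δ

theorem abs_div_sub_div_le {a b s c δ : ℝ} (hc : 0 < c) (hs : c ≤ s)
    (h : |a - b| ≤ δ * c) : |a / s - b / s| ≤ δ := by
  have hs0 : 0 < s := hc.trans_le hs
  rw [← sub_div, abs_div, abs_of_pos hs0, div_le_iff₀ hs0]
  have hδ : 0 ≤ δ := nonneg_of_mul_nonneg_left ((abs_nonneg _).trans h) hc
  exact h.trans (mul_le_mul_of_nonneg_left hs hδ)

theorem SupLipschitz.abs_sub_div_le {Ψ : (ι → ℝ) → ℝ} (hΨ : SupLipschitz Ψ) {σ : ι → ℝ} {c : ℝ}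
    (hc : 0 < c) (hσ : ∀ i, c ≤ σ i) {u v : ι → ℝ} {δ : ℝ} (hδ : 0 ≤ δ) (hv : ∃ C, ∀ i, |v i| ≤ C)
    (h : ∀ i, |u i - v i| ≤ δ * c) :
    |Ψ (fun i => u i / σ i) - Ψ (fun i => v i / σ i)| ≤ δ := by
  obtain ⟨C, hC⟩ := hv
  refine hΨ _ _ δ hδ ⟨C / c, fun i => ?_⟩ fun i => abs_div_sub_div_le hc (hσ i) (h i)
  have := abs_div_sub_div_le (b := 0) (δ := C / c) hc (hσ i)
    (by simpa [div_mul_cancel₀ C hc.ne'] using hC i)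
  simpa using this

/-- The map `J` covers both full paths and paths read only through finitely many coordinates. -/
theorem SupLipschitz.continuous_comp {Ψ : (ι → ℝ) → ℝ} (hΨ : SupLipschitz Ψ) {σ : ι → ℝ} {c : ℝ}
    (hc : 0 < c) (hσ : ∀ i, c ≤ σ i) {E : Type*} [PseudoMetricSpace E] {J : E → ι → ℝ}
    (hJ : ∀ x, ∃ C, ∀ i, |J x i| ≤ C) (hJL : ∀ x y i, |J x i - J y i| ≤ dist x y) :
    Continuous fun x => Ψ fun i => J x i / σ i := by
  have : LipschitzWith (Real.toNNReal c⁻¹) fun x => Ψ fun i => J x i / σ i := by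
    refine LipschitzWith.of_dist_le_mul fun x y => ?_
    have hc' : (0 : ℝ) ≤ c⁻¹ := inv_nonneg.2 hc.le
    rw [Real.dist_eq, Real.coe_toNNReal _ hc']
    refine hΨ.abs_sub_div_le hc hσ (mul_nonneg hc' dist_nonneg) (hJ y) fun i => ?_
    rw [mul_right_comm, inv_mul_cancel₀ hc.ne', one_mul]
    exact hJL x y i
  exact this.continuous

theorem SupLipschitz.continuous_div {Ψ : (ι → ℝ) → ℝ} (hΨ : SupLipschitz Ψ) {σ : ι → ℝ} {c : ℝ}
    (hc : 0 < c) (hσ : ∀ i, c ≤ σ i) :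
    Continuous fun z : EllInfty ι => Ψ fun i => z i / σ i :=
  hΨ.continuous_comp hc hσ (J := fun z i => z i) (fun z => ⟨‖z‖, abs_apply_le_norm z⟩)
    abs_sub_apply_le_dist

theorem exists_modulus_on_bounded {h : ℝ → ℝ} (hh : Continuous h) (M : ℝ) {ε : ℝ} (hε : 0 < ε) :
    ∃ δ > 0, ∀ x y, |x| ≤ M → |y - x| ≤ δ → |h y - h x| ≤ ε := by
  have huc : UniformContinuousOn h (Set.Icc (-(M + 1)) (M + 1)) :=
    isCompact_Icc.uniformContinuousOn_of_continuous hh.continuousOn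
  obtain ⟨δ, hδ, H⟩ := Metric.uniformContinuousOn_iff.1 huc ε hε
  refine ⟨min 1 (δ / 2), lt_min one_pos (half_pos hδ), fun x y hx hxy => ?_⟩
  have h1 := abs_le.1 hx
  have h2 := abs_le.1 (hxy.trans (min_le_left _ _))
  refine (H y ⟨?_, ?_⟩ x ⟨?_, ?_⟩ ?_).le
  any_goals linarith
  rw [Real.dist_eq]
  exact (hxy.trans (min_le_right _ _)).trans_lt (half_lt_self hδ)

/-- The difference is `|x| |s - s'| / (s s')`, and the first tolerance gives `s s' ≥ c² / 2`. -/
theorem abs_div_sub_div_le_of_denominator {x s s' R c δ : ℝ} (hR : 0 < R) (hc : 0 < c)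
    (hs : c ≤ s) (hx : |x| ≤ R) (h1 : |s' - s| ≤ c / 2) (h2 : |s' - s| ≤ δ * c ^ 2 / (2 * R)) :
    |x / s' - x / s| ≤ δ := by
  have hs0 : 0 < s := hc.trans_le hs
  have hs' : c / 2 ≤ s' := by linarith [(abs_le.1 h1).1]
  have hs'0 : 0 < s' := (half_pos hc).trans_le hs'
  have hprod : c / 2 * c ≤ s' * s := mul_le_mul hs' hs hc.le hs'0.le
  have hδ : 0 ≤ δ := by
    have := (abs_nonneg _).trans h2
    rw [le_div_iff₀ (by positivity), zero_mul] at this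
    exact nonneg_of_mul_nonneg_left this (by positivity)
  rw [div_sub_div _ _ hs'0.ne' hs0.ne', abs_div, abs_of_pos (mul_pos hs'0 hs0),
    div_le_iff₀ (mul_pos hs'0 hs0)]
  have h3 : x * s - s' * x = x * (s - s') := by ring
  rw [h3, abs_mul, abs_sub_comm s s']
  calc |x| * |s' - s| ≤ R * (δ * c ^ 2 / (2 * R)) :=
        mul_le_mul hx h2 (abs_nonneg _) hR.le
    _ = δ * (c / 2 * c) := by field_simp
    _ ≤ δ * (s' * s) := mul_le_mul_of_nonneg_left hprod hδ

variable {Ω : Type*} [MeasurableSpace Ω] {μ : Measure Ω}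

theorem UniformlyConsistent.exists_eventually {sigmaHat : ℕ → Ω → ι → ℝ} {σ : ι → ℝ}
    (h : UniformlyConsistent μ sigmaHat σ) {ε η : ℝ} (hε : 0 < ε) (hη : 0 < η) :
    ∀ᶠ k in atTop, μ {ω | ¬ ∀ i, |sigmaHat k ω i - σ i| ≤ ε} ≤ ENNReal.ofReal η := by
  filter_upwards [(h ε hε).eventually_lt_const (by simpa using hη : 0 < ENNReal.ofReal η)] with k hk
  refine (measure_mono fun ω hω => ?_).trans hk.le
  simp only [Set.mem_ofPred_eq, not_forall, not_le] at hω ⊢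
  obtain ⟨i, hi⟩ := hω
  exact ((ENNReal.ofReal_lt_ofReal_iff (hε.trans hi)).2 hi).trans_le
    (le_iSup (fun i => ENNReal.ofReal |sigmaHat k ω i - σ i|) i)

/-- If processes `D k` are asymptotically tight and their finite-dimensional distributions
converge to those of the tight law `ν`, then Lipschitz functionals of the standardized processes
converge weakly. -/
theorem weakConv_of_fdd [IsProbabilityMeasure μ] {ν : Measure (EllInfty ι)} [IsProbabilityMeasure ν]
    (hν : IsTightMeasureSet {ν}) {D : ℕ → Ω → ι → ℝ} (hDm : ∀ k i, Measurable fun ω => D k ω i)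
    (hnet : ∀ ε η : ℝ, 0 < ε → 0 < η → ∃ s : Set (EllInfty ι), s.Finite ∧
      ∀ᶠ k in atTop, μ {ω | D k ω ∉ nearNet s ε} ≤ ENNReal.ofReal η)
    (hfdd : ∀ (I : Finset ι) (H : EuclideanSpace ℝ I →ᵇ ℝ),
      Tendsto (fun k => ∫ ω, H (WithLp.toLp 2 fun i : I => D k ω i) ∂μ) atTop
        (𝓝 (∫ z, H (WithLp.toLp 2 fun i : I => z (i : ι)) ∂ν)))
    {σ : ι → ℝ} {c : ℝ} (hc : 0 < c) (hσ : ∀ i, c ≤ σ i) {sigmaHat : ℕ → Ω → ι → ℝ}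
    (hcons : UniformlyConsistent μ sigmaHat σ) {Ψ : (ι → ℝ) → ℝ} (hΨ : SupLipschitz Ψ) :
    WeakConv μ (fun k ω => Ψ fun i => D k ω i / sigmaHat k ω i)
      (ν.map fun z => Ψ fun i => z i / σ i) := by
  intro h
  have hΨc := hΨ.continuous_div hc hσ
  rw [integral_map hΨc.measurable.aemeasurable h.continuous.measurable.aestronglyMeasurable]
  obtain ⟨B, hB0, hB⟩ : ∃ B : ℝ, 0 < B ∧ ∀ x, |h x| ≤ B :=
    ⟨‖h‖ + 1, by positivity, fun x => (h.norm_coe_le_norm x).trans (by linarith)⟩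
  rw [Metric.tendsto_atTop']
  intro e he
  -- Error budget: `2ε + 2B·3η` for the samples, `e / 4` for the finite-dimensional limit and `ε +
  -- 2B·2η` for the limit law add up to at most `e`.
  set ε := e / 8 with hεdef
  have hε : 0 < ε := by positivity
  set η := e / (32 * B) with hηdef
  have hη : 0 < η := by positivity
  have hBη : 2 * B * (4 * η) = e / 4 := by rw [hηdef]; field_simp; ring
  -- Nets at scale `1` serve only to bound the paths by `R`. This confines `Ψ` to a compact
  -- interval, where `h` has a modulus `δ`; the fine scale `ε'` can be chosen only after `δ`.
  obtain ⟨s₁, hs₁, hD₁⟩ := hnet 1 η one_pos hη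
  obtain ⟨s₂, hs₂, hν₁⟩ := exists_finite_nearNet hν one_pos hη
  obtain ⟨R, hR0, hR⟩ := exists_bound_of_mem_nearNet (hs₁.union hs₂) 1
  set M := |Ψ fun _ => 0| + R / c
  have hΨM : ∀ u : ι → ℝ, (∀ i, |u i| ≤ R) → |Ψ fun i => u i / σ i| ≤ M := by
    intro u hu
    have := hΨ.abs_sub_div_le hc hσ (u := u) (v := fun _ => 0) (δ := R / c) (by positivity)
      ⟨0, by simp⟩ (by simpa [div_mul_cancel₀ R hc.ne'] using hu)
    simp only [zero_div] at this
    have h2 := abs_sub_abs_le_abs_sub (Ψ fun i => u i / σ i) (Ψ fun _ => 0)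
    linarith
  obtain ⟨δ, hδ, hmod⟩ := exists_modulus_on_bounded h.continuous M hε
  -- The `3` absorbs the factor in `abs_sub_le_of_mem_nearNet`, and `c` absorbs the division by `σ`.
  set ε' := δ * c / 3 with hε'
  have hε'0 : 0 < ε' := by positivity
  obtain ⟨t₁, ht₁, hD₂⟩ := hnet ε' η hε'0 hη
  obtain ⟨t₂, ht₂, hν₂⟩ := exists_finite_nearNet hν hε'0 hη
  -- The union of the nets makes one discretization `p` work for the samples and the limit alike.
  obtain ⟨p, hpfin, hp⟩ := exists_finite_range_approx (ht₁.union ht₂) hε'0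
  have happ : ∀ u : ι → ℝ, u ∈ nearNet (s₁ ∪ s₂) 1 → u ∈ nearNet (t₁ ∪ t₂) ε' →
      |h (Ψ fun i => u i / σ i) - h (Ψ fun i => u (p i) / σ i)| ≤ ε := by
    intro u hu hu'
    rw [abs_sub_comm]
    refine hmod _ _ (hΨM u (hR u hu)) ?_
    refine hΨ.abs_sub_div_le (u := fun i => u (p i)) hc hσ hδ.le ⟨R, hR u hu⟩ fun i => ?_
    rw [abs_sub_comm]
    refine (abs_sub_le_of_mem_nearNet hp hu' i).trans (by rw [hε']; linarith)
  set I := hpfin.toFinset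
  have hpI : ∀ i, p i ∈ I := fun i => by simp [I]
  have hJc : Continuous fun v : EuclideanSpace ℝ I => Ψ fun i => v ⟨p i, hpI i⟩ / σ i := by
    refine hΨ.continuous_comp hc hσ (J := fun (v : EuclideanSpace ℝ I) i => v ⟨p i, hpI i⟩)
      (fun v => ⟨‖v‖, fun i => PiLp.norm_apply_le v _⟩) fun v w i => ?_
    rw [dist_eq_norm]
    exact PiLp.norm_apply_le (v - w) _
  let H : EuclideanSpace ℝ I →ᵇ ℝ := h.compContinuous ⟨_, hJc⟩
  have hlim := Metric.tendsto_atTop'.1 (hfdd I H) (e / 4) (by positivity)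
  have hνint : |∫ z, h (Ψ fun i => z i / σ i) ∂ν - ∫ z, h (Ψ fun i => z (p i) / σ i) ∂ν| ≤
      ε + 2 * B * (2 * η) := by
    have hm1 : Measurable fun z : EllInfty ι => h (Ψ fun i => z i / σ i) :=
      (h.continuous.comp hΨc).measurable
    have hm2 : Measurable fun z : EllInfty ι => h (Ψ fun i => z (p i) / σ i) := by
      refine (h.continuous.comp (hΨ.continuous_comp hc hσ (J := fun (z : EllInfty ι) i => z (p i))
        (fun z => ⟨‖z‖, fun i => abs_apply_le_norm z _⟩)
        fun z w i => abs_sub_apply_le_dist z w _)).measurable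
    -- Read as an outer expectation, the integral falls under the same comparison lemma as the
    -- samples.
    rw [← outerExp_eq_integral ν _ hm1 (Integrable.of_bound hm1.aestronglyMeasurable B
      (ae_of_all _ fun z => hB _))]
    refine abs_outerExp_sub_integral_le (A := {z | (z : ι → ℝ) ∉ nearNet s₂ 1} ∪
      {z | (z : ι → ℝ) ∉ nearNet t₂ ε'}) (fun z => hB _) (fun z => hB _) hm2 hε.le (by positivity)
      ?_ fun z hz => ?_
    · refine (measure_union_le _ _).trans ((add_le_add hν₁ hν₂).trans_eq ?_)
      rw [← ENNReal.ofReal_add hη.le hη.le, two_mul]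
    · simp only [Set.mem_union, Set.mem_ofPred_eq, not_or, not_not] at hz
      exact happ z (nearNet_mono Set.subset_union_right 1 hz.1)
        (nearNet_mono Set.subset_union_right ε' hz.2)
  set δ' := min (c / 2) (δ * c ^ 2 / (2 * R))
  have hδ'0 : 0 < δ' := by positivity
  obtain ⟨N, hN⟩ := hlim
  have hev : ∀ᶠ k in atTop, dist (outerExp μ fun ω => h (Ψ fun i => D k ω i / sigmaHat k ω i))
      (∫ z, h (Ψ fun i => z i / σ i) ∂ν) < e := by
    filter_upwards [hD₁, hD₂, hcons.exists_eventually hδ'0 hη, eventually_gt_atTop N] with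
      k h1 h2 h3 h4
    have hk := hN k h4
    rw [Real.dist_eq] at hk ⊢
    have hm : Measurable fun ω => h (Ψ fun i => D k ω (p i) / σ i) := by
      have : Measurable fun ω => (WithLp.toLp 2 fun i : I => D k ω i : EuclideanSpace ℝ I) :=
        (WithLp.measurable_toLp 2 _).comp (measurable_pi_lambda _ fun i => hDm k i)
      exact H.continuous.measurable.comp this
    -- Off the exceptional set `A` the paths are bounded by `R` and `sigmaHat ≥ c / 2`, so default
    -- values of division by zero or of unbounded suprema occur only inside `A`.
    have hout := abs_outerExp_sub_integral_le (μ := μ) (ε := 2 * ε) (η := 3 * η) (B := B)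
      (Z := fun ω => h (Ψ fun i => D k ω i / sigmaHat k ω i))
      (V := fun ω => h (Ψ fun i => D k ω (p i) / σ i))
      (A := {ω | D k ω ∉ nearNet s₁ 1} ∪ {ω | D k ω ∉ nearNet t₁ ε'} ∪
        {ω | ¬ ∀ i, |sigmaHat k ω i - σ i| ≤ δ'})
      (fun ω => hB _) (fun ω => hB _) hm (by positivity) (by positivity) ?_ fun ω hω => ?_
    · change |∫ ω, h (Ψ fun i => D k ω (p i) / σ i) ∂μ -
        ∫ z, h (Ψ fun i => z (p i) / σ i) ∂ν| < e / 4 at hk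
      have a1 := abs_le.1 hout
      have a2 := abs_lt.1 hk
      have a3 := abs_le.1 hνint
      have e1 : 2 * B * (3 * η) ≤ e / 4 := by rw [← hBη]; gcongr; norm_num
      have e2 : 2 * B * (2 * η) = e / 8 := by linarith
      rw [abs_lt]
      constructor <;> linarith
    · refine (measure_union_le _ _).trans
        ((add_le_add ((measure_union_le _ _).trans (add_le_add h1 h2)) h3).trans_eq ?_)
      rw [← ENNReal.ofReal_add hη.le hη.le, ← ENNReal.ofReal_add (by positivity) hη.le]
      congr 1
      ring
    · simp only [Set.mem_union, Set.mem_ofPred_eq, not_or, not_not] at hω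
      have hu1 := nearNet_mono (Set.subset_union_left (t := s₂)) 1 hω.1.1
      have hu2 := nearNet_mono (Set.subset_union_left (t := t₂)) ε' hω.1.2
      have b1 := happ (D k ω) hu1 hu2
      have b2 : |h (Ψ fun i => D k ω i / sigmaHat k ω i) - h (Ψ fun i => D k ω i / σ i)| ≤ ε := by
        refine hmod _ _ (hΨM _ (hR _ hu1)) (hΨ _ _ δ hδ.le ⟨R / c, fun i => ?_⟩ fun i => ?_)
        · have := abs_div_sub_div_le (a := D k ω i) (b := 0) (δ := R / c) hc (hσ i)
            (by simpa [div_mul_cancel₀ R hc.ne'] using hR _ hu1 i)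
          simpa using this
        · exact abs_div_sub_div_le_of_denominator hR0 hc (hσ i) (hR _ hu1 i)
            ((hω.2 i).trans (min_le_left _ _)) ((hω.2 i).trans (min_le_right _ _))
      have := abs_sub_le (h (Ψ fun i => D k ω i / sigmaHat k ω i)) (h (Ψ fun i => D k ω i / σ i))
        (h (Ψ fun i => D k ω (p i) / σ i))
      linarith
  obtain ⟨N', hN'⟩ := eventually_atTop.1 hev
  exact ⟨N', fun k hk => hN' k hk.le⟩

/-! ### The functionals in the theorem. -/

theorem supLipschitz_eval (i : ι) : SupLipschitz fun u : ι → ℝ => u i :=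
  fun _ _ _ _ _ h => h i

/-- Boundedness of `v` passes to `u`; without it the real supremum could take its default value `0`
and the estimate would fail. -/
theorem supLipschitz_iSup {S : Set ι} (hS : S.Nonempty) :
    SupLipschitz fun u : ι → ℝ => ⨆ i : S, u i := by
  intro u v δ _ ⟨C, hC⟩ h
  have := hS.to_subtype
  have hv : BddAbove (Set.range fun i : S => v i) :=
    ⟨C, by rintro _ ⟨i, rfl⟩; exact (abs_le.1 (hC i)).2⟩
  have hu : BddAbove (Set.range fun i : S => u i) :=
    ⟨C + δ, by rintro _ ⟨i, rfl⟩; linarith [(abs_le.1 (hC i)).2, (abs_le.1 (h i)).2]⟩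
  have h1 : ⨆ i : S, u i ≤ (⨆ i : S, v i) + δ :=
    ciSup_le fun i => by linarith [le_ciSup hv i, (abs_le.1 (h i)).2]
  have h2 : ⨆ i : S, v i ≤ (⨆ i : S, u i) + δ :=
    ciSup_le fun i => by linarith [le_ciSup hu i, (abs_le.1 (h i)).1]
  rw [abs_le]
  constructor <;> linarith

theorem supLipschitz_iInf {S : Set ι} (hS : S.Nonempty) :
    SupLipschitz fun u : ι → ℝ => ⨅ i : S, u i := by
  intro u v δ _ ⟨C, hC⟩ h
  have := hS.to_subtype
  have hv : BddBelow (Set.range fun i : S => v i) :=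
    ⟨-C, by rintro _ ⟨i, rfl⟩; exact (abs_le.1 (hC i)).1⟩
  have hu : BddBelow (Set.range fun i : S => u i) :=
    ⟨-C - δ, by rintro _ ⟨i, rfl⟩; linarith [(abs_le.1 (hC i)).1, (abs_le.1 (h i)).1]⟩
  have h1 : (⨅ i : S, v i) - δ ≤ ⨅ i : S, u i :=
    le_ciInf fun i => by linarith [ciInf_le hv i, (abs_le.1 (h i)).1]
  have h2 : (⨅ i : S, u i) - δ ≤ ⨅ i : S, v i :=
    le_ciInf fun i => by linarith [ciInf_le hu i, (abs_le.1 (h i)).2]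
  rw [abs_le]
  constructor <;> linarith

theorem supLipschitz_iSup_abs {S : Set ι} (hS : S.Nonempty) :
    SupLipschitz fun u : ι → ℝ => ⨆ i : S, |u i| := by
  intro u v δ hδ ⟨C, hC⟩ h
  exact supLipschitz_iSup hS (fun i => |u i|) (fun i => |v i|) δ hδ ⟨C, by simpa using hC⟩
    fun i => (abs_abs_sub_abs_le (u i) (v i)).trans (h i)

end LipschitzFunctionals

/-! ### The central limit theorem for empirical processes -/

section CentralLimit

variable {𝒴 : Type*} [MeasurableSpace 𝒴] {P : Measure 𝒴}

theorem measurable_empProc {g : 𝒴 → ℝ} (hg : Measurable g) (n : ℕ) :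
    Measurable fun y : ℕ → 𝒴 => empProc P n y g := by
  unfold empProc empMean
  fun_prop

theorem empProc_eq (n : ℕ) (y : ℕ → 𝒴) (g : 𝒴 → ℝ) :
    empProc P n y g = (√(n : ℝ))⁻¹ * (∑ i ∈ Finset.range n, g (y i) - n * ∫ x, g x ∂P) := by
  rcases Nat.eq_zero_or_pos n with rfl | hn
  · simp [empProc]
  · have hn' : (0 : ℝ) < n := Nat.cast_pos.2 hn
    have h : √(n : ℝ) = (√(n : ℝ))⁻¹ * n := by
      rw [inv_mul_eq_div, Real.div_sqrt]
    rw [empProc, empMean]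
    nth_rw 1 [h]
    field_simp

theorem bridgeCov_eq_covariance [IsProbabilityMeasure P] {f g : 𝒴 → ℝ} (hf : MemLp f 2 P)
    (hg : MemLp g 2 P) : bridgeCov P f g = cov[f, g; P] := by
  rw [covariance_eq_sub hf hg]
  rfl

theorem bridgeCov_self [IsProbabilityMeasure P] {f : 𝒴 → ℝ} (hf : MemLp f 2 P) :
    bridgeCov P f f = Var[f; P] := by
  rw [bridgeCov_eq_covariance hf hf, covariance_self hf.aestronglyMeasurable.aemeasurable]

theorem tendstoInDistribution_empProc {Ω : Type*} [MeasurableSpace Ω] {μ : Measure Ω}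
    [IsProbabilityMeasure μ] [IsProbabilityMeasure P] {Y : ℕ → Ω → 𝒴} (hY : ∀ i, Measurable (Y i))
    (hlaw : ∀ i, μ.map (Y i) = P) (hind : iIndepFun Y μ) {g : 𝒴 → ℝ} (hg : Measurable g)
    (hg2 : MemLp g 2 P) :
    TendstoInDistribution (fun n ω => empProc P n (fun i => Y i ω) g) atTop (id : ℝ → ℝ)
      (fun _ => μ) (gaussianReal 0 (bridgeCov P g g).toNNReal) := by
  have hid : ∀ i, IdentDistrib (fun ω => g (Y i ω)) (fun ω => g (Y 0 ω)) μ μ := fun i =>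
    (IdentDistrib.mk (hY i).aemeasurable (hY 0).aemeasurable (by rw [hlaw, hlaw])).comp hg
  have hmp : MeasurePreserving (Y 0) μ P := ⟨hY 0, hlaw 0⟩
  have hmean : μ[fun ω => g (Y 0 ω)] = ∫ x, g x ∂P := by
    rw [← hlaw 0, integral_map (hY 0).aemeasurable hg.aestronglyMeasurable]
  have hvar : Var[fun ω => g (Y 0 ω); μ] = bridgeCov P g g := by
    rw [bridgeCov_self hg2, ← hlaw 0, variance_map hg.aemeasurable (hY 0).aemeasurable]
    rfl
  have := tendstoInDistribution_inv_sqrt_mul_sum_sub (P := μ) (X := fun i ω => g (Y i ω))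
    (Y := (id : ℝ → ℝ)) (P' := gaussianReal 0 (bridgeCov P g g).toNNReal)
    ⟨aemeasurable_id, by rw [Measure.map_id, hvar]⟩ (hg2.comp_measurePreserving hmp)
    (hind.comp (fun _ => g) fun _ => hg) hid
  rw [hmean] at this
  simpa only [empProc_eq] using this

theorem tendsto_integral_of_tendstoInDistribution {Ω Ω' E : Type*} [MeasurableSpace Ω]
    [MeasurableSpace Ω'] [TopologicalSpace E] [MeasurableSpace E] [BorelSpace E] {μ : Measure Ω}
    [IsProbabilityMeasure μ] {μ' : Measure Ω'} [IsProbabilityMeasure μ'] {X : ℕ → Ω → E}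
    {Z : Ω' → E} (h : TendstoInDistribution X atTop Z (fun _ => μ) μ') (H : E →ᵇ ℝ) :
    Tendsto (fun k => ∫ ω, H (X k ω) ∂μ) atTop (𝓝 (∫ ω, H (Z ω) ∂μ')) := by
  have := ProbabilityMeasure.tendsto_iff_forall_integral_tendsto.1 h.tendsto H
  simp only [ProbabilityMeasure.coe_mk] at this
  rw [integral_map h.aemeasurable_limit H.continuous.measurable.aestronglyMeasurable] at this
  refine this.congr fun k => ?_
  rw [integral_map (h.forall_aemeasurable k) H.continuous.measurable.aestronglyMeasurable]

/-! ### Linear combinations of members of the class -/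

variable {F : Set (𝒴 → ℝ)}

/-- The linear combination of the functions in `I` with coefficients `t`. -/
def linComb (I : Finset F) (t : F → ℝ) (y : 𝒴) : ℝ := ∑ f ∈ I, t f * (f : 𝒴 → ℝ) y

theorem measurable_linComb (hF : ∀ f ∈ F, Measurable f) (I : Finset F) (t : F → ℝ) :
    Measurable (linComb I t) :=
  Finset.measurable_sum _ fun f _ => (hF f f.2).const_mul _

theorem memLp_linComb (hF : ∀ f ∈ F, MemLp f 2 P) (I : Finset F) (t : F → ℝ) :
    MemLp (linComb I t) 2 P :=
  memLp_finsetSum _ fun f _ => (hF f f.2).const_mul (t f)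

theorem integral_linComb [IsProbabilityMeasure P] (hF : ∀ f ∈ F, MemLp f 2 P) (I : Finset F)
    (t : F → ℝ) : ∫ y, linComb I t y ∂P = ∑ f ∈ I, t f * ∫ y, (f : 𝒴 → ℝ) y ∂P := by
  simp only [linComb]
  rw [integral_finsetSum _ fun (f : F) _ => ((hF f f.2).integrable (by norm_num)).const_mul (t f)]
  simp only [integral_const_mul]

theorem empMean_linComb {𝒳 : Type*} {F : Set (𝒳 → ℝ)} (n : ℕ) (y : ℕ → 𝒳) (I : Finset F)
    (t : F → ℝ) :
    empMean n y (linComb I t) = ∑ f ∈ I, t f * empMean n y f := by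
  simp only [empMean, linComb]
  rw [Finset.sum_comm, Finset.sum_div]
  simp only [← Finset.mul_sum, mul_div_assoc]

theorem empProc_linComb [IsProbabilityMeasure P] (hF : ∀ f ∈ F, MemLp f 2 P) (n : ℕ) (y : ℕ → 𝒴)
    (I : Finset F) (t : F → ℝ) :
    empProc P n y (linComb I t) = ∑ f ∈ I, t f * empProc P n y f := by
  simp only [empProc]
  rw [empMean_linComb, integral_linComb hF, ← Finset.sum_sub_distrib, Finset.mul_sum]
  exact Finset.sum_congr rfl fun f _ => by ring

theorem bridgeCov_linComb [IsProbabilityMeasure P] (hF : ∀ f ∈ F, MemLp f 2 P) (I : Finset F)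
    (t : F → ℝ) : bridgeCov P (linComb I t) (linComb I t) =
      ∑ f ∈ I, ∑ g ∈ I, t f * t g * bridgeCov P f g := by
  have hm : ∀ f ∈ I, MemLp (fun y => t f * (f : 𝒴 → ℝ) y) 2 P :=
    fun f _ => (hF f f.2).const_mul (t f)
  rw [bridgeCov_eq_covariance (memLp_linComb hF I t) (memLp_linComb hF I t)]
  refine (covariance_fun_sum_fun_sum' hm hm).trans ?_
  refine Finset.sum_congr rfl fun f _ => Finset.sum_congr rfl fun g _ => ?_
  rw [covariance_const_mul_left, covariance_const_mul_right,
    bridgeCov_eq_covariance (hF f f.2) (hF g g.2)]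
  ring

theorem bridgeCov_self_nonneg [IsProbabilityMeasure P] {f : 𝒴 → ℝ} (hf : MemLp f 2 P) :
    0 ≤ bridgeCov P f f := bridgeCov_self hf ▸ variance_nonneg _ _

theorem diffCov_linComb {Pa Pb : Measure 𝒴} [IsProbabilityMeasure Pa] [IsProbabilityMeasure Pb]
    (hFa : ∀ f ∈ F, MemLp f 2 Pa) (hFb : ∀ f ∈ F, MemLp f 2 Pb) (lam : ℝ) (I : Finset F)
    (t : F → ℝ) : diffCov Pa Pb lam (linComb I t) (linComb I t) =
      ∑ f ∈ I, ∑ g ∈ I, t f * t g * diffCov Pa Pb lam f g := by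
  simp only [diffCov, bridgeCov_linComb hFa, bridgeCov_linComb hFb, Finset.mul_sum,
    ← Finset.sum_add_distrib]
  exact Finset.sum_congr rfl fun f _ => Finset.sum_congr rfl fun g _ => by ring

theorem continuous_linear_eval {ι : Type*} (I : Finset ι) (t : ι → ℝ) :
    Continuous fun z : EllInfty ι => ∑ i ∈ I, t i * z i :=
  continuous_finsetSum _ fun i _ => continuous_const.mul (continuous_eval i)

/-- The finite-dimensional distributions of the limit law of a Donsker class. -/
theorem map_linear_eval_eq_gaussianReal [IsProbabilityMeasure P] (hFm : ∀ f ∈ F, Measurable f)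
    (hF : ∀ f ∈ F, MemLp f 2 P) {G : ℕ → (ℕ → 𝒴) → EllInfty F}
    (hG : ∀ n y (f : F), G n y f = empProc P n y f) {ν : Measure (EllInfty F)}
    [IsProbabilityMeasure ν] (hw : WeakConv (Measure.infinitePi fun _ : ℕ => P) G ν)
    (I : Finset F) (t : F → ℝ) :
    ν.map (fun z => ∑ f ∈ I, t f * z f) =
      gaussianReal 0 (bridgeCov P (linComb I t) (linComb I t)).toNNReal := by
  have hc := continuous_linear_eval I t
  have := Measure.isProbabilityMeasure_map (μ := ν) hc.measurable.aemeasurable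
  have hgm := measurable_linComb hFm I t
  refine ext_of_forall_integral_eq_of_IsFiniteMeasure fun H => ?_
  have h1 := hw (H.compContinuous ⟨_, hc⟩)
  have h2 := tendsto_integral_of_tendstoInDistribution
    (tendstoInDistribution_empProc (μ := Measure.infinitePi fun _ : ℕ => P)
      (Y := fun i y => y i) (fun i => measurable_pi_apply i)
      (fun i => Measure.infinitePi_map_eval (fun _ : ℕ => P) i)
      (iIndepFun_infinitePi (P := fun _ : ℕ => P) (X := fun _ y => y) fun _ => measurable_id)
      hgm (memLp_linComb hF I t)) H
  rw [integral_map hc.measurable.aemeasurable H.continuous.measurable.aestronglyMeasurable]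
  -- The same expectations converge by the Donsker property and by the scalar central limit theorem
  -- for the linear combination, so the limits agree.
  refine tendsto_nhds_unique (h1.congr fun n => ?_) h2
  have hm : Measurable fun y : ℕ → 𝒴 => H (empProc P n y (linComb I t)) :=
    H.continuous.measurable.comp (measurable_empProc hgm n)
  rw [← outerExp_eq_integral _ _ hm (Integrable.of_bound hm.aestronglyMeasurable ‖H‖
    (ae_of_all _ fun y => H.norm_coe_le_norm _))]
  congr 1
  funext y
  simp [empProc_linComb hF, hG]

end CentralLimit

/-! ### Characterization of tight Gaussian laws by linear combinations -/

section GaussianLaw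

variable {ι : Type*} {ν : Measure (EllInfty ι)} {K : ι → ι → ℝ}

theorem IsTightGaussianLaw.map_linear_eval (h : IsTightGaussianLaw ν K) (I : Finset ι)
    (t : ι → ℝ) : ν.map (fun z => ∑ i ∈ I, t i * z i) =
      gaussianReal 0 (∑ i ∈ I, ∑ j ∈ I, t i * t j * K i j).toNNReal := by
  have := h.isProbabilityMeasure
  have hLp : ∀ i, MemLp (fun z : EllInfty ι => z i) 2 ν := fun i =>
    (h.gaussian.hasGaussianLaw_eval i).memLp_two
  have hg : HasGaussianLaw (fun z : EllInfty ι => ∑ i ∈ I, t i * z i) ν := by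
    have hI := h.gaussian.hasGaussianLaw I
    let L : (I → ℝ) →L[ℝ] ℝ := ∑ i : I, t i • ContinuousLinearMap.proj i
    have := hI.map L
    convert! this using 1
    funext z
    simp [L, Finset.sum_attach I fun i => t i * z i]
  rw [hg.map_eq_gaussianReal]
  have hm : ∀ i ∈ I, MemLp (fun z : EllInfty ι => t i * z i) 2 ν :=
    fun i _ => (hLp i).const_mul (t i)
  congr 2
  · rw [integral_finsetSum _ fun i hi => (hm i hi).integrable (by norm_num)]
    simp [integral_const_mul, h.mean_zero]
  · rw [← covariance_self (continuous_linear_eval I t).measurable.aemeasurable,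
      covariance_fun_sum_fun_sum' hm hm]
    refine Finset.sum_congr rfl fun i _ => Finset.sum_congr rfl fun j _ => ?_
    rw [covariance_const_mul_left, covariance_const_mul_right, covariance_eq_sub (hLp i) (hLp j),
      h.mean_zero i, zero_mul, sub_zero, ← h.cov i j]
    simp only [Pi.mul_apply]
    ring

/-- Every linear functional of finitely many coordinates is such a combination, which gives joint
Gaussianity; covariances follow from variances by polarization. `hpos` ensures that `toNNReal`
truncates nothing. -/
theorem isTightGaussianLaw_of_map_linear_eval [IsProbabilityMeasure ν]
    (htight : IsTightMeasureSet {ν}) (hsymm : ∀ i j, K i j = K j i)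
    (hpos : ∀ (I : Finset ι) (t : ι → ℝ), 0 ≤ ∑ i ∈ I, ∑ j ∈ I, t i * t j * K i j)
    (h : ∀ (I : Finset ι) (t : ι → ℝ), ν.map (fun z => ∑ i ∈ I, t i * z i) =
      gaussianReal 0 (∑ i ∈ I, ∑ j ∈ I, t i * t j * K i j).toNNReal) :
    IsTightGaussianLaw ν K := by
  have hlaw : ∀ (I : Finset ι) (t : ι → ℝ), HasLaw (fun z : EllInfty ι => ∑ i ∈ I, t i * z i)
      (gaussianReal 0 (∑ i ∈ I, ∑ j ∈ I, t i * t j * K i j).toNNReal) ν := fun I t =>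
    ⟨(continuous_linear_eval I t).measurable.aemeasurable, h I t⟩
  have hgl : ∀ (I : Finset ι) (t : ι → ℝ),
      HasGaussianLaw (fun z : EllInfty ι => ∑ i ∈ I, t i * z i) ν := fun I t =>
    (hlaw I t).hasGaussianLaw
  have hsingle : ∀ i, (fun z : EllInfty ι => ∑ j ∈ {i}, (1 : ℝ) * z j) = fun z => z i := by
    intro i; simp
  have hLp : ∀ i, MemLp (fun z : EllInfty ι => z i) 2 ν := fun i => by
    have := (hgl {i} fun _ => 1).memLp_two
    rwa [hsingle] at this
  have hmean : ∀ i, ∫ z, z i ∂ν = 0 := fun i => by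
    have := (hlaw {i} fun _ => 1).integral_eq
    rw [hsingle] at this
    rw [this]
    exact integral_id_gaussianReal
  have hvar : ∀ I : Finset ι, Var[fun z : EllInfty ι => ∑ i ∈ I, z i; ν] =
      ∑ i ∈ I, ∑ j ∈ I, K i j := fun I => by
    have h1 := (hlaw I fun _ => 1).variance_eq
    rw [variance_id_gaussianReal, Real.coe_toNNReal _ (hpos I fun _ => 1)] at h1
    simpa using h1
  have hsq : ∀ i, ∫ z, z i * z i ∂ν = K i i := fun i => by
    have := hvar {i}
    simp only [Finset.sum_singleton] at this
    rw [variance_eq_sub (hLp i), hmean i] at this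
    simpa [pow_two] using this
  refine ⟨inferInstance, htight, ⟨fun I => ⟨⟨fun L => ?_⟩⟩⟩, hmean, fun i j => ?_⟩
  · classical
    have hm : Measurable fun z : EllInfty ι => I.restrict (fun i => z i) :=
      measurable_pi_lambda _ fun i => measurable_eval _
    let t : ι → ℝ := fun i => if hi : i ∈ I then L (Pi.single ⟨i, hi⟩ 1) else 0
    have hL : ∀ z : EllInfty ι, L (I.restrict fun i => z i) = ∑ i ∈ I, t i * z i := by
      intro z
      rw [← Finset.sum_attach I fun i => t i * z i]
      conv_lhs => rw [← Finset.univ_sum_single (I.restrict fun i => z i)]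
      rw [map_sum]
      refine Finset.sum_congr rfl fun i _ => ?_
      have : (Pi.single i (I.restrict (fun i => z i) i) : I → ℝ) =
          z (i : ι) • (Pi.single i 1 : I → ℝ) := by
        rw [← Pi.single_smul]; simp
      rw [this, map_smul]
      simp [t, mul_comm]
    have hfun : (fun z : EllInfty ι => L (I.restrict fun i => z i)) =
        fun z => ∑ i ∈ I, t i * z i := funext hL
    have hcomp : (ν.map fun z : EllInfty ι => I.restrict (fun i => z i)).map L =
        ν.map fun z : EllInfty ι => ∑ i ∈ I, t i * z i := by
      rw [Measure.map_map L.continuous.measurable hm, ← hfun]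
      rfl
    have e := (hgl I t).map_eq_gaussianReal
    rw [hcomp, e]
    congr 1
    · rw [integral_map hm.aemeasurable L.continuous.measurable.aestronglyMeasurable]
      simp only [hL]
    · rw [variance_map L.continuous.measurable.aemeasurable hm.aemeasurable]
      congr 2
      exact hfun.symm
  · rcases eq_or_ne i j with rfl | hij
    · exact hsq i
    · classical
      have h2 := hvar {i, j}
      simp only [Finset.sum_pair hij] at h2
      have hadd := variance_add (hLp i) (hLp j)
      have : Var[(fun z : EllInfty ι => z i) + fun z => z j; ν] =
        Var[fun z : EllInfty ι => z i + z j; ν] := rfl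
      rw [this, h2] at hadd
      have hi := hvar {i}
      have hj := hvar {j}
      simp only [Finset.sum_singleton] at hi hj
      rw [hi, hj, covariance_eq_sub (hLp i) (hLp j), hmean i, zero_mul, sub_zero,
        hsymm j i] at hadd
      simp only [Pi.mul_apply] at hadd
      linarith

end GaussianLaw

/-! ### Sums of independent tight laws on a Banach space -/

section TightSum

/-- Take the union of compact sets missing mass at most `1 / (n + 1)`. -/
theorem exists_isSeparable_compl_null {E : Type*} [PseudoMetricSpace E] [MeasurableSpace E]
    {ν : Measure E} (hν : IsTightMeasureSet {ν}) :
    ∃ S : Set E, TopologicalSpace.IsSeparable S ∧ ν Sᶜ = 0 := by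
  have hK := isTightMeasureSet_iff_exists_isCompact_measure_compl_le.1 hν
  choose K hKc hKν using fun n : ℕ => hK ((n : ℝ≥0∞) + 1)⁻¹ (by simp)
  refine ⟨⋃ n, K n, .iUnion fun n => (hKc n).isSeparable, ?_⟩
  have hlim : Tendsto (fun n : ℕ => ((n : ℝ≥0∞) + 1)⁻¹) atTop (𝓝 0) := by
    have := ENNReal.tendsto_inv_nat_nhds_zero.comp (tendsto_add_atTop_nat 1)
    simpa [Function.comp_def] using this
  refine le_antisymm (ge_of_tendsto' hlim fun n => ?_) zero_le
  exact (measure_mono (Set.compl_subset_compl.2 (Set.subset_iUnion K n))).trans (hKν n ν rfl)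

/-- On a nonseparable `E`, addition need not be measurable for the product of the Borel σ-algebras.
Tight laws live on a closed separable subspace `W`, where it is, so the product law is formed on `W
× W` and pushed forward. -/
theorem exists_tight_law_add_mul {E : Type*} [NormedAddCommGroup E] [NormedSpace ℝ E]
    [CompleteSpace E] [MeasurableSpace E] [BorelSpace E] {νa νb : Measure E}
    [IsProbabilityMeasure νa] [IsProbabilityMeasure νb] (ha : IsTightMeasureSet {νa})
    (hb : IsTightMeasureSet {νb}) (r : ℝ) :
    ∃ ν : Measure E, IsProbabilityMeasure ν ∧ IsTightMeasureSet {ν} ∧ ∀ φ : E →L[ℝ] ℝ,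
      ν.map φ = ((νa.map φ).prod (νb.map φ)).map fun q => q.1 + r * q.2 := by
  obtain ⟨Sa, hSa, ha0⟩ := exists_isSeparable_compl_null ha
  obtain ⟨Sb, hSb, hb0⟩ := exists_isSeparable_compl_null hb
  let W : Submodule ℝ E := (Submodule.span ℝ (Sa ∪ Sb)).topologicalClosure
  have hWc : IsClosed (W : Set E) := Submodule.isClosed_topologicalClosure _
  have hWm : MeasurableSet (W : Set E) := hWc.measurableSet
  have hsub : Sa ∪ Sb ⊆ W :=
    Submodule.subset_span.trans (Submodule.le_topologicalClosure (Submodule.span ℝ (Sa ∪ Sb)))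
  have hWsep : TopologicalSpace.IsSeparable (W : Set E) := by
    simpa only [W, Submodule.topologicalClosure_coe] using ((hSa.union hSb).span (R := ℝ)).closure
  have : TopologicalSpace.SeparableSpace W := hWsep.separableSpace
  have : SecondCountableTopology W := UniformSpace.secondCountable_of_separable W
  have : CompleteSpace W := hWc.completeSpace_coe
  have hemb : MeasurableEmbedding (Subtype.val : W → E) := MeasurableEmbedding.subtype_coe hWm
  have hmap : ∀ ν : Measure E, ν (W : Set E)ᶜ = 0 → (ν.comap (Subtype.val : W → E)).map
      Subtype.val = ν := by
    intro ν h
    rw [hemb.map_comap, Subtype.range_coe]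
    exact Measure.restrict_eq_self_of_ae_mem (by rw [ae_iff]; exact h)
  have ha1 := hmap νa (measure_mono_null
    (Set.compl_subset_compl.2 (Set.subset_union_left.trans hsub)) ha0)
  have hb1 := hmap νb (measure_mono_null
    (Set.compl_subset_compl.2 (Set.subset_union_right.trans hsub)) hb0)
  set νa' := νa.comap (Subtype.val : W → E)
  set νb' := νb.comap (Subtype.val : W → E)
  have hval : Measurable (Subtype.val : W → E) := measurable_subtype_coe
  have : IsProbabilityMeasure νa' := by
    have : IsProbabilityMeasure (νa'.map Subtype.val) := by rwa [ha1]
    exact Measure.isProbabilityMeasure_of_map Subtype.val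
  have : IsProbabilityMeasure νb' := by
    have : IsProbabilityMeasure (νb'.map Subtype.val) := by rwa [hb1]
    exact Measure.isProbabilityMeasure_of_map Subtype.val
  have hθ : Continuous fun q : W × W => (q.1 : E) + r • (q.2 : E) := by fun_prop
  refine ⟨(νa'.prod νb').map fun q => (q.1 : E) + r • (q.2 : E),
    Measure.isProbabilityMeasure_map hθ.measurable.aemeasurable, ?_, fun φ => ?_⟩
  · have := (isTightMeasureSet_singleton (μ := νa'.prod νb')).map hθ
    rwa [Set.image_singleton] at this
  · have hφ := φ.continuous.measurable
    rw [Measure.map_map hφ hθ.measurable]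
    conv_rhs => rw [← ha1, ← hb1]
    rw [Measure.map_map hφ hval, Measure.map_map hφ hval,
      Measure.map_prod_map _ _ (hφ.comp hval) (hφ.comp hval),
      Measure.map_map (by fun_prop) ((hφ.comp hval).prodMap (hφ.comp hval))]
    congr 1
    funext q
    simp

theorem gaussianReal_prod_map_add_mul {v w : ℝ} (hv : 0 ≤ v) (hw : 0 ≤ w) (r : ℝ) :
    ((gaussianReal 0 v.toNNReal).prod (gaussianReal 0 w.toNNReal)).map
      (fun q => q.1 + r * q.2) = gaussianReal 0 (v + r ^ 2 * w).toNNReal := by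
  have hsnd : ((gaussianReal 0 v.toNNReal).prod (gaussianReal 0 w.toNNReal)).map Prod.snd =
      gaussianReal 0 w.toNNReal := measurePreserving_snd.map_eq
  have h := gaussianReal_add_gaussianReal_of_indepFun
    (P := (gaussianReal 0 v.toNNReal).prod (gaussianReal 0 w.toNNReal))
    (X := fun q => q.1) (Y := fun q => r * q.2) (m₁ := 0) (m₂ := r * 0) (v₁ := v.toNNReal)
    (v₂ := .mk (r ^ 2) (sq_nonneg _) * w.toNNReal)
    (indepFun_prod (X := id) (Y := fun x => r * x) measurable_id (by fun_prop))
    measurePreserving_fst.map_eq (by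
      rw [← gaussianReal_map_const_mul]
      conv_rhs => rw [← hsnd]
      rw [Measure.map_map (by fun_prop) measurable_snd]
      rfl)
  refine h.trans ?_
  congr 1
  · simp
  · ext
    rw [NNReal.coe_add, NNReal.coe_mul, Real.coe_toNNReal _ hv, Real.coe_toNNReal _ hw,
      Real.coe_toNNReal _ (by positivity)]
    rfl

end TightSum

/-! ### Existence of the limit process -/

section TwoSample

variable {𝒴 : Type*} [MeasurableSpace 𝒴] {Pa Pb : Measure 𝒴} {F : Set (𝒴 → ℝ)}

theorem SampleSizes.lam_nonneg {na nb : ℕ → ℕ} {lam : ℝ} (h : SampleSizes na nb lam) :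
    0 ≤ lam :=
  ge_of_tendsto' h.tendsto_ratio fun _ => by positivity

theorem diffCov_self_nonneg [IsProbabilityMeasure Pa] [IsProbabilityMeasure Pb] {lam : ℝ}
    (hlam : 0 ≤ lam) {f : 𝒴 → ℝ} (ha : MemLp f 2 Pa) (hb : MemLp f 2 Pb) :
    0 ≤ diffCov Pa Pb lam f f :=
  add_nonneg (bridgeCov_self_nonneg ha) (mul_nonneg hlam (bridgeCov_self_nonneg hb))

theorem bridgeCov_comm (P : Measure 𝒴) (f g : 𝒴 → ℝ) : bridgeCov P f g = bridgeCov P g f := by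
  simp only [bridgeCov, mul_comm]

theorem exists_isTightGaussianLaw_diffCov [IsProbabilityMeasure Pa] [IsProbabilityMeasure Pb]
    (hFa : IsDonsker Pa F) (hFb : IsDonsker Pb F) {lam : ℝ} (hlam : 0 ≤ lam) :
    ∃ ν : Measure (EllInfty F),
      IsTightGaussianLaw ν (fun f g : F => diffCov Pa Pb lam f g) := by
  obtain ⟨Ga, hGa, νa, hνa, hta, hwa⟩ := hFa.weakConv
  obtain ⟨Gb, hGb, νb, hνb, htb, hwb⟩ := hFb.weakConv
  -- The sign of `√lam` is immaterial, since the second limit is a centred Gaussian; only its square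
  -- enters the covariance.
  obtain ⟨ν, hν, ht, hmap⟩ := exists_tight_law_add_mul hta htb (√lam)
  refine ⟨ν, isTightGaussianLaw_of_map_linear_eval ht (fun f g => ?_) (fun I t => ?_)
    fun I t => ?_⟩
  · simp only [diffCov, bridgeCov_comm]
  · rw [← diffCov_linComb hFa.memLp hFb.memLp]
    exact diffCov_self_nonneg hlam (memLp_linComb hFa.memLp I t) (memLp_linComb hFb.memLp I t)
  · let φ : EllInfty F →L[ℝ] ℝ := ∑ f ∈ I, t f • lp.evalCLM ℝ (fun _ : F => ℝ) ∞ f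
    have hφ : (φ : EllInfty F → ℝ) = fun z => ∑ f ∈ I, t f * z f := by
      funext z
      simp [φ]
      rfl
    have h := hmap φ
    rw [hφ, map_linear_eval_eq_gaussianReal hFa.measurable hFa.memLp hGa hwa,
      map_linear_eval_eq_gaussianReal hFb.measurable hFb.memLp hGb hwb,
      gaussianReal_prod_map_add_mul (bridgeCov_self_nonneg (memLp_linComb hFa.memLp I t))
        (bridgeCov_self_nonneg (memLp_linComb hFb.memLp I t)), Real.sq_sqrt hlam] at h
    rw [h, ← diffCov_linComb hFa.memLp hFb.memLp]
    rfl

/-! ### The two-sample process -/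

/-- For `nb = 0` the quotient is `0` by convention and the centring of the second sample would be
lost. -/
theorem diffProc_eq {na nb : ℕ} (hb : nb ≠ 0) (ya yb : ℕ → 𝒴) (g : 𝒴 → ℝ) :
    diffProc Pa Pb na nb ya yb g =
      empProc Pa na ya g - √((na : ℝ) / nb) * empProc Pb nb yb g := by
  have hb' : √(nb : ℝ) ≠ 0 := (Real.sqrt_pos.2 (Nat.cast_pos.2 (Nat.pos_of_ne_zero hb))).ne'
  rw [diffProc, empProc, empProc, Real.sqrt_div (Nat.cast_nonneg _)]
  field_simp
  ring

theorem measurable_diffProc {Ω : Type*} [MeasurableSpace Ω] {Ya Yb : ℕ → Ω → 𝒴}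
    (hYa : ∀ i, Measurable (Ya i)) (hYb : ∀ i, Measurable (Yb i)) {g : 𝒴 → ℝ} (hg : Measurable g)
    (na nb : ℕ) :
    Measurable fun ω => diffProc Pa Pb na nb (fun i => Ya i ω) (fun i => Yb i ω) g := by
  unfold diffProc empMean
  fun_prop

theorem diffProc_linComb [IsProbabilityMeasure Pa] [IsProbabilityMeasure Pb]
    (hFa : ∀ f ∈ F, MemLp f 2 Pa) (hFb : ∀ f ∈ F, MemLp f 2 Pb) (na nb : ℕ) (ya yb : ℕ → 𝒴)
    (I : Finset F) (t : F → ℝ) : diffProc Pa Pb na nb ya yb (linComb I t) =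
      ∑ f ∈ I, t f * diffProc Pa Pb na nb ya yb f := by
  simp only [diffProc]
  rw [empMean_linComb, empMean_linComb, integral_linComb hFa, integral_linComb hFb,
    ← Finset.sum_sub_distrib, ← Finset.sum_sub_distrib, ← Finset.sum_sub_distrib, Finset.mul_sum]
  exact Finset.sum_congr rfl fun f _ => by ring

variable {Ω : Type*} [MeasurableSpace Ω] {μ : Measure Ω}
  {Ya Yb : ℕ → Ω → 𝒴} {na nb : ℕ → ℕ} {lam : ℝ}

/-! ### Finite-dimensional convergence of the two-sample process. -/

theorem tendsto_charFun_diffProc [IsProbabilityMeasure μ] [IsProbabilityMeasure Pa]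
    [IsProbabilityMeasure Pb]
    (hY : TwoSamples μ Ya Yb Pa Pb) (hn : SampleSizes na nb lam) {g : 𝒴 → ℝ} (hg : Measurable g)
    (ha : MemLp g 2 Pa) (hb : MemLp g 2 Pb) (s : ℝ) :
    Tendsto (fun k => charFun (μ.map fun ω =>
      diffProc Pa Pb (na k) (nb k) (fun i => Ya i ω) (fun i => Yb i ω) g) s) atTop
      (𝓝 (charFun (gaussianReal 0 (diffCov Pa Pb lam g g).toNNReal) s)) := by
  have hA := tendstoInDistribution_empProc hY.measurable_a hY.law_a hY.indep_a hg ha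
  have hB := tendstoInDistribution_empProc hY.measurable_b hY.law_b hY.indep_b hg hb
  have hB' : TendstoInDistribution (fun k ω => empProc Pb (nb k) (fun i => Yb i ω) g) atTop
      (id : ℝ → ℝ) (fun _ => μ) (gaussianReal 0 (bridgeCov Pb g g).toNNReal) :=
    ⟨fun k => hB.forall_aemeasurable (nb k), hB.aemeasurable_limit,
      hB.tendsto.comp hn.tendsto_b⟩
  have hr : Tendsto (fun k => -√((na k : ℝ) / nb k)) atTop (𝓝 (-√lam)) :=
    (hn.tendsto_ratio.sqrt).neg
  -- Slutsky's lemma with the deterministic coefficient `-√(n_a/n_b)`.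
  have hB'' := hB'.continuous_comp_prodMk_of_tendstoInMeasure_const
    (g := fun q : ℝ × ℝ => q.2 * q.1) (by fun_prop)
    (Y := fun k _ => -√((na k : ℝ) / nb k)) (c := -√lam)
    (tendstoInMeasure_of_tendsto_ae (fun k => aestronglyMeasurable_const)
      (ae_of_all _ fun _ => hr)) fun k => aemeasurable_const
  have cA := (ProbabilityMeasure.tendsto_iff_tendsto_charFun.1
    (hA.tendsto.comp hn.tendsto_a)) s
  have cB := (ProbabilityMeasure.tendsto_iff_tendsto_charFun.1 hB''.tendsto) s
  simp only [ProbabilityMeasure.coe_mk, Measure.map_id, id] at cA cB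
  have hlim := cA.mul cB
  have hva := bridgeCov_self_nonneg ha
  have hvb := bridgeCov_self_nonneg hb
  have hvd : 0 ≤ bridgeCov Pa g g + lam * bridgeCov Pb g g :=
    diffCov_self_nonneg hn.lam_nonneg ha hb
  have hval : charFun (gaussianReal 0 (bridgeCov Pa g g).toNNReal) s *
      charFun ((gaussianReal 0 (bridgeCov Pb g g).toNNReal).map fun x => -√lam * x) s =
      charFun (gaussianReal 0 (diffCov Pa Pb lam g g).toNNReal) s := by
    rw [gaussianReal_map_const_mul, charFun_gaussianReal, charFun_gaussianReal,
      charFun_gaussianReal, ← Complex.exp_add]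
    congr 1
    simp only [NNReal.coe_mul, NNReal.coe_mk, Real.coe_toNNReal _ hva, Real.coe_toNNReal _ hvb,
      Real.coe_toNNReal _ hvd, neg_sq,
      Real.sq_sqrt hn.lam_nonneg, diffCov]
    push_cast
    ring
  rw [hval] at hlim
  refine hlim.congr' ?_
  filter_upwards [hn.tendsto_b.eventually_ne_atTop 0] with k hk
  have hmA : Measurable fun ω => empProc Pa (na k) (fun i => Ya i ω) g :=
    (measurable_empProc hg (na k)).comp (measurable_pi_lambda _ hY.measurable_a)
  have hmB : Measurable fun ω => -√((na k : ℝ) / nb k) * empProc Pb (nb k) (fun i => Yb i ω) g :=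
    ((measurable_empProc hg (nb k)).comp (measurable_pi_lambda _ hY.measurable_b)).const_mul _
  have hind : IndepFun (fun ω => empProc Pa (na k) (fun i => Ya i ω) g)
      (fun ω => -√((na k : ℝ) / nb k) * empProc Pb (nb k) (fun i => Yb i ω) g) μ :=
    hY.indep_ab.comp (measurable_empProc hg (na k)) ((measurable_empProc hg (nb k)).const_mul _)
  have := congrFun (hind.charFun_map_fun_add_eq_mul hmA.aemeasurable hmB.aemeasurable) s
  rw [Pi.mul_apply] at this
  refine this.symm.trans ?_
  congr 2
  funext ω
  rw [diffProc_eq hk]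
  ring

/-- The Cramér–Wold reduction: `⟪X, t⟫` is a linear combination of coordinates, with `t` extended by
zero to all of `ι`. -/
theorem charFun_map_toLp {ι Ω : Type*} [MeasurableSpace Ω] {μ : Measure Ω} {I : Finset ι}
    {X : ι → Ω → ℝ} (hX : ∀ i, Measurable (X i)) (t : EuclideanSpace ℝ I) :
    charFun (μ.map fun ω => (WithLp.toLp 2 fun i : I => X i ω : EuclideanSpace ℝ I)) t =
      charFun (μ.map fun ω => ∑ i ∈ I, Function.extend Subtype.val t 0 i * X i ω) 1 := by
  have hm : Measurable fun ω => (WithLp.toLp 2 fun i : I => X i ω : EuclideanSpace ℝ I) :=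
    (WithLp.measurable_toLp 2 _).comp (measurable_pi_lambda _ fun i => hX i)
  have hm' : Measurable fun ω => ∑ i ∈ I, Function.extend Subtype.val t 0 i * X i ω :=
    Finset.measurable_sum _ fun i _ => (hX i).const_mul _
  rw [charFun_apply, charFun_apply, integral_map hm.aemeasurable (by fun_prop),
    integral_map hm'.aemeasurable (by fun_prop)]
  congr 1
  funext ω
  congr 3
  rw [← Finset.sum_attach I, PiLp.inner_apply]
  simp

theorem tendsto_integral_diffProc [IsProbabilityMeasure μ] [IsProbabilityMeasure Pa]
    [IsProbabilityMeasure Pb]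
    (hFa : IsDonsker Pa F) (hFb : IsDonsker Pb F) (hY : TwoSamples μ Ya Yb Pa Pb)
    (hn : SampleSizes na nb lam) {ν : Measure (EllInfty F)}
    (hν : IsTightGaussianLaw ν (fun f g : F => diffCov Pa Pb lam f g)) (I : Finset F)
    (H : EuclideanSpace ℝ I →ᵇ ℝ) :
    Tendsto (fun k => ∫ ω, H (WithLp.toLp 2 fun f : I =>
      diffProc Pa Pb (na k) (nb k) (fun i => Ya i ω) (fun i => Yb i ω) (f : F)) ∂μ) atTop
      (𝓝 (∫ z, H (WithLp.toLp 2 fun f : I => z (f : F)) ∂ν)) := by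
  have := hν.isProbabilityMeasure
  have hD : ∀ k (f : F), Measurable fun ω =>
      diffProc Pa Pb (na k) (nb k) (fun i => Ya i ω) (fun i => Yb i ω) f := fun k f =>
    measurable_diffProc hY.measurable_a hY.measurable_b (hFa.measurable f f.2) _ _
  refine tendsto_integral_of_tendstoInDistribution (X := fun k ω => WithLp.toLp 2 fun f : I =>
      diffProc Pa Pb (na k) (nb k) (fun i => Ya i ω) (fun i => Yb i ω) (f : F))
      (Z := fun z : EllInfty F => WithLp.toLp 2 fun f : I => z (f : F))
      ⟨fun k => ?_, ?_, ProbabilityMeasure.tendsto_iff_tendsto_charFun.2 fun t => ?_⟩ H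
  · exact ((WithLp.measurable_toLp 2 _).comp
      (measurable_pi_lambda _ fun f : I => hD k f)).aemeasurable
  · exact ((WithLp.measurable_toLp 2 _).comp
      (measurable_pi_lambda _ fun f => measurable_eval _)).aemeasurable
  · simp only [ProbabilityMeasure.coe_mk]
    rw [charFun_map_toLp (X := fun (f : F) (z : EllInfty F) => z f) measurable_eval t,
      hν.map_linear_eval, ← diffCov_linComb hFa.memLp hFb.memLp]
    refine (tendsto_charFun_diffProc hY hn (measurable_linComb hFa.measurable I _)
      (memLp_linComb hFa.memLp I _) (memLp_linComb hFb.memLp I _) 1).congr fun k => ?_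
    rw [charFun_map_toLp (hD k) t]
    simp only [diffProc_linComb hFa.memLp hFb.memLp]

/-! ### Asymptotic tightness of the two-sample process. -/

theorem exists_finite_nearNet_empProc {P : Measure 𝒴} [IsProbabilityMeasure P] (hF : IsDonsker P F)
    {Y : ℕ → Ω → 𝒴} (hYm : ∀ i, Measurable (Y i)) (hlaw : ∀ i, μ.map (Y i) = P)
    (hind : iIndepFun Y μ) {ε η : ℝ} (hε : 0 < ε) (hη : 0 < η) :
    ∃ s : Set (EllInfty F), s.Finite ∧ ∀ᶠ n in atTop,
      μ {ω | (fun f : F => empProc P n (fun i => Y i ω) f) ∉ nearNet s ε} ≤ ENNReal.ofReal η := by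
  obtain ⟨G, hG, ν, hν, ht, hw⟩ := hF.weakConv
  obtain ⟨s, hs, hev⟩ := hw.exists_finite_nearNet ht hε hη
  refine ⟨s, hs, hev.mono fun n hn => ?_⟩
  have hm : Measurable fun ω i => Y i ω := measurable_pi_lambda _ hYm
  have hmap : μ.map (fun ω i => Y i ω) = Measure.infinitePi fun _ : ℕ => P := by
    rw [hind.map_fun_eq_infinitePi_map₀ hm.aemeasurable]
    simp only [hlaw]
  rw [← hmap] at hn
  refine le_trans ?_ hn
  -- The exceptional set need not be measurable; this inequality for its preimage under the sample
  -- map holds for every set.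
  refine le_trans (measure_mono fun ω hω => ?_) (Measure.le_map_apply hm.aemeasurable _)
  have : (G n (fun i => Y i ω) : F → ℝ) = fun f : F => empProc P n (fun i => Y i ω) f :=
    funext fun f => hG n _ f
  simpa only [Set.mem_preimage, Set.mem_ofPred_eq, this] using hω

theorem exists_finite_nearNet_diffProc [IsProbabilityMeasure Pa] [IsProbabilityMeasure Pb]
    (hFa : IsDonsker Pa F) (hFb : IsDonsker Pb F) (hY : TwoSamples μ Ya Yb Pa Pb)
    (hn : SampleSizes na nb lam) {ε η : ℝ} (hε : 0 < ε) (hη : 0 < η) :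
    ∃ s : Set (EllInfty F), s.Finite ∧ ∀ᶠ k in atTop,
      μ {ω | (fun f : F => diffProc Pa Pb (na k) (nb k) (fun i => Ya i ω) (fun i => Yb i ω) f) ∉
        nearNet s ε} ≤ ENNReal.ofReal η := by
  set r := √lam
  have hr0 : 0 ≤ r := Real.sqrt_nonneg _
  have hr : Tendsto (fun k => √((na k : ℝ) / nb k)) atTop (𝓝 r) := hn.tendsto_ratio.sqrt
  obtain ⟨sa, hsa, ha⟩ := exists_finite_nearNet_empProc hFa hY.measurable_a hY.law_a hY.indep_a
    (ε := ε / 3) (by positivity) (half_pos hη)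
  obtain ⟨sb, hsb, hb⟩ := exists_finite_nearNet_empProc hFb hY.measurable_b hY.law_b hY.indep_b
    (ε := ε / (3 * (r + 1))) (by positivity) (half_pos hη)
  obtain ⟨C, hC⟩ := (hsb.image norm).bddAbove
  -- The `1` gives `q ≤ r + 1`, matching the scale chosen for `sb`; the other term makes `|(q - r) *
  -- v f|` at most `ε / 3` on the finite net.
  set δ := min 1 (ε / (3 * (|C| + 1)))
  have hδ : 0 < δ := by positivity
  refine ⟨Set.image2 (fun w v => w - r • v) sa sb, hsa.image2 _ hsb, ?_⟩
  filter_upwards [hn.tendsto_a.eventually ha, hn.tendsto_b.eventually hb,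
    hn.tendsto_b.eventually_ne_atTop 0, Metric.tendsto_nhds.1 hr δ hδ] with k h1 h2 h3 h4
  refine (measure_mono ?_).trans ((measure_union_le _ _).trans ((add_le_add h1 h2).trans_eq ?_))
  · intro ω hω
    by_contra hcon
    simp only [Set.mem_union, Set.mem_ofPred_eq, not_or, not_not] at hcon
    obtain ⟨⟨w, hw, hw'⟩, v, hv, hv'⟩ := hcon
    refine hω ⟨w - r • v, Set.mem_image2_of_mem hw hv, fun f => ?_⟩
    change |diffProc Pa Pb (na k) (nb k) (fun i => Ya i ω) (fun i => Yb i ω) f -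
      (w f - r * v f)| ≤ ε
    rw [diffProc_eq h3]
    set A := empProc Pa (na k) (fun i => Ya i ω) f
    set B := empProc Pb (nb k) (fun i => Yb i ω) f
    set q := √((na k : ℝ) / nb k)
    have e1 : |A - w f| ≤ ε / 3 := hw' f
    have e2 : |B - v f| ≤ ε / (3 * (r + 1)) := hv' f
    have e3 : |v f| ≤ |C| :=
      (abs_apply_le_norm v f).trans ((hC ⟨v, hv, rfl⟩).trans (le_abs_self C))
    have e4 : |q - r| < δ := h4
    have e5 : q ≤ r + 1 := by
      linarith [(abs_lt.1 e4).2, min_le_left (1 : ℝ) (ε / (3 * (|C| + 1)))]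
    have e6 : |q - r| ≤ ε / (3 * (|C| + 1)) := e4.le.trans (min_le_right _ _)
    have hsplit : A - q * B - (w f - r * v f) = (A - w f) - q * (B - v f) - (q - r) * v f := by
      ring
    have m1 : |q * (B - v f)| ≤ ε / 3 := by
      rw [abs_mul, abs_of_nonneg (Real.sqrt_nonneg _)]
      calc q * |B - v f| ≤ (r + 1) * (ε / (3 * (r + 1))) :=
            mul_le_mul e5 e2 (abs_nonneg _) (by positivity)
        _ = ε / 3 := by field_simp
    have m2 : |(q - r) * v f| ≤ ε / 3 := by
      rw [abs_mul]
      calc |q - r| * |v f| ≤ ε / (3 * (|C| + 1)) * (|C| + 1) :=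
            mul_le_mul e6 (e3.trans (by linarith)) (abs_nonneg _) (by positivity)
        _ = ε / 3 := by field_simp
    rw [hsplit, abs_le]
    have n1 := abs_le.1 e1
    have n2 := abs_le.1 m1
    have n3 := abs_le.1 m2
    constructor <;> linarith
  · rw [← ENNReal.ofReal_add (half_pos hη).le (half_pos hη).le, add_halves]

theorem map_tLimit_eq_gaussianReal {ν : Measure (EllInfty F)}
    (hν : IsTightGaussianLaw ν (fun f g : F => diffCov Pa Pb lam f g)) (f : F)
    (hf : 0 < diffCov Pa Pb lam f f) :
    (ν.map fun z => tLimit Pa Pb lam z f) = gaussianReal 0 1 := by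
  have h := hν.map_linear_eval {f} fun _ => 1
  simp only [Finset.sum_singleton, one_mul] at h
  have hcomp : (ν.map fun z => tLimit Pa Pb lam z f) =
      (ν.map fun z : EllInfty F => z f).map (· / sigma Pa Pb lam f) := by
    rw [Measure.map_map (by fun_prop) (measurable_eval f)]
    rfl
  rw [hcomp, h, gaussianReal_map_div_const, zero_div]
  congr 1
  ext
  rw [NNReal.coe_div, Real.coe_toNNReal _ hf.le, NNReal.coe_mk, sigma, Real.sq_sqrt hf.le,
    NNReal.coe_one, div_self hf.ne']

end TwoSample

end EUProcess

end

/-! ### The theorem, from one statement about Lipschitz functionals. -/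

open EUProcess in
theorem mainTheorem7 {𝒴 Ω : Type*} [MeasurableSpace 𝒴] [MeasurableSpace Ω]
    (μ : Measure Ω) [IsProbabilityMeasure μ]
    (Pa Pb : Measure 𝒴) [IsProbabilityMeasure Pa] [IsProbabilityMeasure Pb]
    (F : Set (𝒴 → ℝ)) (hFa : IsDonsker Pa F) (hFb : IsDonsker Pb F)
    (Ya Yb : ℕ → Ω → 𝒴) (hY : TwoSamples μ Ya Yb Pa Pb)
    (na nb : ℕ → ℕ) (lam : ℝ) (hn : SampleSizes na nb lam)
    (hσ : ∃ c : ℝ, 0 < c ∧ ∀ f ∈ F, c ≤ diffCov Pa Pb lam f f)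
    (sigmaHat : ℕ → Ω → F → ℝ)
    (hσhat : UniformlyConsistent μ sigmaHat (fun f : F => sigma Pa Pb lam f)) :
    (∃ ν : Measure (EllInfty F),
      IsTightGaussianLaw ν (fun f g : F => diffCov Pa Pb lam f g)) ∧
    ∀ ν : Measure (EllInfty F),
      IsTightGaussianLaw ν (fun f g : F => diffCov Pa Pb lam f g) →
      (∀ f : F,
        WeakConv μ (fun k ω => tStat Pa Pb na nb Ya Yb sigmaHat k ω f) (ν.map fun z => tLimit Pa Pb lam z f) ∧
        (ν.map fun z => tLimit Pa Pb lam z f) = gaussianReal 0 1) ∧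
      ∀ S : Set F, S.Nonempty →
        WeakConv μ (fun k ω => ⨆ f : S, tStat Pa Pb na nb Ya Yb sigmaHat k ω f)
          (ν.map fun z => ⨆ f : S, tLimit Pa Pb lam z f) ∧
        WeakConv μ (fun k ω => ⨅ f : S, tStat Pa Pb na nb Ya Yb sigmaHat k ω f)
          (ν.map fun z => ⨅ f : S, tLimit Pa Pb lam z f) ∧
        WeakConv μ (fun k ω => ⨆ f : S, |tStat Pa Pb na nb Ya Yb sigmaHat k ω f|)
          (ν.map fun z => ⨆ f : S, |tLimit Pa Pb lam z f|) := by
  have hc : ∃ c : ℝ, 0 < c ∧ ∀ f : F, c ≤ sigma Pa Pb lam f := by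
    obtain ⟨c, hc, h⟩ := hσ
    exact ⟨√c, Real.sqrt_pos.2 hc, fun f => Real.sqrt_le_sqrt (h f f.2)⟩
  obtain ⟨c, hc0, hc⟩ := hc
  refine ⟨exists_isTightGaussianLaw_diffCov hFa hFb hn.lam_nonneg, fun ν hν => ?_⟩
  have := hν.isProbabilityMeasure
  have key : ∀ Ψ : (F → ℝ) → ℝ, SupLipschitz Ψ →
      WeakConv μ (fun k ω => Ψ fun f => tStat Pa Pb na nb Ya Yb sigmaHat k ω f)
        (ν.map fun z => Ψ fun f => tLimit Pa Pb lam z f) := fun Ψ hΨ =>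
    weakConv_of_fdd (D := fun k ω (f : F) =>
        diffProc Pa Pb (na k) (nb k) (fun i => Ya i ω) (fun i => Yb i ω) f)
      (σ := fun f : F => sigma Pa Pb lam f) (sigmaHat := sigmaHat) hν.tight
      (fun k f => measurable_diffProc hY.measurable_a hY.measurable_b (hFa.measurable f f.2) _ _)
      (fun ε η hε hη => exists_finite_nearNet_diffProc hFa hFb hY hn hε hη)
      (fun I H => tendsto_integral_diffProc hFa hFb hY hn hν I H) hc0 hc hσhat hΨ
  refine ⟨fun f => ⟨key (fun u => u f) (supLipschitz_eval f), ?_⟩, fun S hS =>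
    ⟨key (fun u => ⨆ f : S, u f) (supLipschitz_iSup hS),
      key (fun u => ⨅ f : S, u f) (supLipschitz_iInf hS),
      key (fun u => ⨆ f : S, |u f|) (supLipschitz_iSup_abs hS)⟩⟩
  obtain ⟨d, hd, h⟩ := hσ
  exact map_tLimit_eq_gaussianReal hν f (hd.trans_le (h f f.2))
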